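/- There is an absolute constant $c_0\ge 1$, and for every integer $d\ge 1$ there are constants $c_d,c'_d>0$ depending only on $d$, such that for every $\delta>0$ there is $\kappa=\kappa(d,\delta)>0$ for which the following holds. Let $n,m,D,R$ be natural numbers with $1\le m\le c_d\,\delta\, n$ and $R=\delta\binom{n+d-1}{d}$, let $\rho>0$, and let $\Psi:(\mathbb{R}^n)^{\otimes d}\to\mathbb{R}^D$ be a linear operator with $\sigma_R(\Psi)\ge 1$, where $(\mathbb{R}^n)^{\otimes d}\cong\mathbb{R}^{n^d}$ carries the Euclidean inner product of coordinates and $\sigma_k$ denotes the $k$-th largest singular value. Let $\tilde U^{(1)},\dots,\tilde U^{(d)}\in\mathbb{R}^{n\times m}$ be random matrices with $$\tilde U^{(j)}=U^{(j)}+Z^{(j)}\qquad (j=1,\dots,d),$$ where $Z^{(j)}$ has i.i.d. $\mathcal N(0,\rho^2)$ entries, and $U^{(j)}$ is an arbitrary random matrix that may depend on $\tilde U^{(j+1)},\dots,\tilde U^{(d)}$; precisely, for each $j$ the noise $Z^{(j)}$ is independent of $(U^{(j)},\tilde U^{(j+1)},\dots,\tilde U^{(d)})$ jointly. Then with probability at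 least $1-\exp(-\kappa n)$, $$\sigma_{m^d}\Big(\Psi\big(\tilde U^{(1)}\otimes\cdots\otimes\tilde U^{(d)}\big)\Big)\ \ge\ \frac{c'_d\,\rho^d}{n^{c_0 d}},$$ where $\tilde U^{(1)}\otimes\cdots\otimes\tilde U^{(d)}$ is the $n^d\times m^d$ Kronecker product. -/

import Mathlib

open MeasureTheory ProbabilityTheory

/-- The `k`-th largest singular value `σ_k(T)`, counted with multiplicity, for `k ≥ 1`. Mathlib's
sequence `LinearMap.singularValues` starts at index `0`, hence the shift. (`k = 0` is not used.) -/
noncomputable def kthSingularValue {ι κ : Type*} [Fintype ι] [Fintype κ]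
    (k : ℕ) (T : EuclideanSpace ℝ ι →ₗ[ℝ] EuclideanSpace ℝ κ) : ℝ :=
  T.singularValues (k - 1)

/-- The space `(ℝⁿ)^{⊗ d}` of `n × ⋯ × n` tensors of order `d`, with its Euclidean (Frobenius)
inner product: a tensor is the family of its coordinates, indexed by `(i₁, …, i_d) ∈ [n]^d`. -/
abbrev TensorSpace (n d : ℕ) : Type := EuclideanSpace ℝ (Fin d → Fin n)

/-- The Kronecker product `U⁽¹⁾ ⊗ ⋯ ⊗ U⁽ᵈ⁾` of `d` matrices of size `n × m`, as a matrix with rows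
indexed by `[n]^d` and columns indexed by `[m]^d`. -/
def kronecker {d n m : ℕ} (U : Fin d → Matrix (Fin n) (Fin m) ℝ) :
    Matrix (Fin d → Fin n) (Fin d → Fin m) ℝ :=
  Matrix.of fun I J => ∏ j, U j (I j) (J j)

/-- The smoothed modal contraction `Ψ (U⁽¹⁾ ⊗ ⋯ ⊗ U⁽ᵈ⁾) : (ℝᵐ)^{⊗ d} → ℝᴰ`. -/
noncomputable def modalContraction {d n m D : ℕ}
    (Ψ : TensorSpace n d →ₗ[ℝ] EuclideanSpace ℝ (Fin D))
    (U : Fin d → Matrix (Fin n) (Fin m) ℝ) :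
    TensorSpace m d →ₗ[ℝ] EuclideanSpace ℝ (Fin D) :=
  Ψ ∘ₗ (kronecker U).toEuclideanLin

/-- `Z` is a random `n × m` matrix with i.i.d. entries of law `N(0, ρ²)`. -/
structure IsIIDGaussianMatrix {Ω : Type*} [MeasurableSpace Ω] (P : Measure Ω) {n m : ℕ} (ρ : ℝ)
    (Z : Ω → Matrix (Fin n) (Fin m) ℝ) : Prop where
  law : ∀ a b, HasLaw (fun ω => Z ω a b) (gaussianReal 0 (ρ ^ 2).toNNReal) P
  indep : iIndepFun (fun (ab : Fin n × Fin m) (ω : Ω) => Z ω ab.1 ab.2) P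

/-- `U⁽¹⁾ + Z⁽¹⁾, …, U⁽ᵈ⁾ + Z⁽ᵈ⁾` is a sequence of random matrices that is generated from the last
one to the first one, by adding fresh noise `Z⁽ʲ⁾`, with i.i.d. entries of law `N(0, ρ²)`, to a base
matrix `U⁽ʲ⁾` that may be random and may depend on the matrices `U⁽ᵏ⁾ + Z⁽ᵏ⁾` with `k > j`: the noise
`Z⁽ʲ⁾` is independent of `U⁽ʲ⁾` and these later matrices jointly. -/
structure IsBackwardPerturbation {Ω : Type*} [MeasurableSpace Ω] (P : Measure Ω) {d n m : ℕ} (ρ : ℝ)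
    (U Z : Fin d → Ω → Matrix (Fin n) (Fin m) ℝ) : Prop where
  aemeasurable_base : ∀ j a b, AEMeasurable (fun ω => U j ω a b) P
  gaussian_noise : ∀ j, IsIIDGaussianMatrix P ρ (Z j)
  /-- Matrices are written as families of entries here, with the product σ-algebra. -/
  indep : ∀ j, IndepFun
    (fun ω => (fun a b => Z j ω a b : Fin n → Fin m → ℝ))
    (fun ω => ((fun a b => U j ω a b : Fin n → Fin m → ℝ),
      (fun k a b => U k ω a b + Z k ω a b : {k : Fin d // j < k} → Fin n → Fin m → ℝ))) P

/-! The proof counts large singular values modulo a subspace. `RobustRank T E r θ` says that `T` has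
`r` of size at least `θ` modulo `E`; by `RobustRank.sup`, enlarging `E` by a space `F` costs at most
`dim F`.

One random vector `v = u + z`. Regard the tensor as `n` blocks `F i` of `N` columns each, of robust
rank `R` about `δ n N`. Some block has robust rank about `δ N / 8` (`RobustRank.exists_block`).
Moving `z i` by more than `ρ / 2` changes the contraction `∑ v i • F i` by a large multiple of that
block, so two such positions cannot both give small rank (`RobustRank.add_smul_or`). The bad values
of `z i` thus have diameter at most `ρ / 2` and Gaussian probability at most `1/4`. Modulo the range
of `F i`, the bad event no longer depends on `z i`, and this quotient costs only `N` in rank. The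
argument can hence be repeated about `δ n / 8` times with the factors `1/4` multiplying: this is
`measure_not_robustRank_contractFst_le`.

All matrices. The last index is contracted first, since later matrices may influence earlier ones.
Each column of the last matrix is treated modulo the contractions with the other `m - 1` columns,
whose span has dimension at most `(m - 1) N`, small against `δ n N`. By induction on `d`, the
remaining matrices keep the contraction with that column injective modulo the others
(`measure_not_robustRank_contract_le`), and blocks that are injective modulo each other assemble
with a loss of `√m` (`robustRank_uncurry_of_forall`). Each index divides `δ` by `16` and multiplies
the bound by `ρ / (4 √n √m)`; the union bounds cost a polynomial factor, absorbed by the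
exponential. -/

/-! ### Singular values modulo a subspace -/

section RobustRank

variable {X Y : Type*} [NormedAddCommGroup X] [InnerProductSpace ℝ X] [FiniteDimensional ℝ X]
  [NormedAddCommGroup Y] [InnerProductSpace ℝ Y] [FiniteDimensional ℝ Y]

/-- The map `T`, composed with the projection to `Y ⧸ E`, has at least `r` singular values that are
at least `θ`. -/
def RobustRank (T : X →ₗ[ℝ] Y) (E : Submodule ℝ Y) (r : ℕ) (θ : ℝ) : Prop :=
  ∃ W : Submodule ℝ X, r ≤ Module.finrank ℝ W ∧ ∀ x ∈ W, ∀ e ∈ E, θ * ‖x‖ ≤ ‖T x + e‖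

omit [FiniteDimensional ℝ X] [FiniteDimensional ℝ Y] in
lemma RobustRank.mono {T : X →ₗ[ℝ] Y} {E E' : Submodule ℝ Y} {r r' : ℕ} {θ θ' : ℝ}
    (h : RobustRank T E r θ) (hE : E' ≤ E) (hr : r' ≤ r) (hθ : θ' ≤ θ) :
    RobustRank T E' r' θ' := by
  obtain ⟨W, hW, h⟩ := h
  exact ⟨W, hr.trans hW, fun x hx e he =>
    (mul_le_mul_of_nonneg_right hθ (norm_nonneg x)).trans (h x hx e (hE he))⟩

-- Together with `exists_starProjection_orthogonal_eq_add`, this identifies the quotient norm modulo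
-- `E` with the norm of the projection to `Eᗮ`.
omit [FiniteDimensional ℝ X] in
lemma norm_starProjection_orthogonal_le (E : Submodule ℝ Y) (y e : Y) (he : e ∈ E) :
    ‖Eᗮ.starProjection y‖ ≤ ‖y + e‖ := by
  have : Eᗮ.starProjection y = Eᗮ.starProjection (y + e) := by
    have h0 : Eᗮ.starProjection e = 0 := by
      rw [Submodule.starProjection_apply_eq_zero_iff]
      simpa using he
    rw [map_add, h0, add_zero]
  rw [this]
  exact Submodule.norm_starProjection_apply_le Eᗮ _

omit [FiniteDimensional ℝ X] in
lemma exists_starProjection_orthogonal_eq_add (E : Submodule ℝ Y) (y : Y) :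
    ∃ e ∈ E, Eᗮ.starProjection y = y + e := by
  refine ⟨-E.starProjection y, E.neg_mem (Submodule.starProjection_apply_mem _ _), ?_⟩
  rw [Submodule.starProjection_orthogonal']
  simp [sub_eq_add_neg]

omit [FiniteDimensional ℝ X] in
lemma OrthonormalBasis.norm_sq_eq_sum_repr_sq {ι : Type*} [Fintype ι] (b : OrthonormalBasis ι ℝ X)
    (x : X) : ‖x‖ ^ 2 = ∑ i, b.repr x i ^ 2 := by
  rw [← b.repr.norm_map, EuclideanSpace.norm_sq_eq]
  simp

omit [FiniteDimensional ℝ X] in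
lemma OrthonormalBasis.repr_eq_zero_of_mem_span {ι : Type*} [Fintype ι]
    (b : OrthonormalBasis ι ℝ X) {S : Finset ι} {x : X}
    (hx : x ∈ Submodule.span ℝ (b '' (S : Set ι))) {i : ι} (hi : i ∉ S) : b.repr x i = 0 := by
  classical
  induction hx using Submodule.span_induction with
  | mem x hx =>
    obtain ⟨j, hj, rfl⟩ := hx
    have : i ≠ j := by rintro rfl; exact hi hj
    simp [this]
  | zero => simp
  | add x y _ _ hx hy => simp [hx, hy]
  | smul a x _ hx => simp [hx]

omit [FiniteDimensional ℝ X] in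
lemma OrthonormalBasis.finrank_span_image {ι : Type*} [Fintype ι]
    (b : OrthonormalBasis ι ℝ X) (S : Finset ι) :
    Module.finrank ℝ (Submodule.span ℝ (b '' (S : Set ι))) = S.card := by
  have hli : LinearIndependent ℝ (fun i : S => b i) :=
    b.orthonormal.linearIndependent.comp _ Subtype.val_injective
  have h := finrank_span_eq_card hli
  rw [Fintype.card_coe] at h
  have hr : b '' (S : Set _) = Set.range fun i : S => b i := by ext; simp
  rw [hr, h]

/-- An orthonormal eigenbasis of `B* B` diagonalises `‖B x‖ ^ 2`, so that bounds on `B` become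
comparisons of eigenvalues, coordinate by coordinate. -/
lemma LinearMap.norm_sq_apply_eq_sum_eigenvalues (B : X →ₗ[ℝ] Y) (x : X) :
    ‖B x‖ ^ 2 = ∑ i, B.isSymmetric_adjoint_comp_self.eigenvalues rfl i *
      (B.isSymmetric_adjoint_comp_self.eigenvectorBasis rfl).repr x i ^ 2 := by
  set hs := B.isSymmetric_adjoint_comp_self
  rw [← real_inner_self_eq_norm_sq, ← LinearMap.adjoint_inner_right,
    ← (hs.eigenvectorBasis rfl).repr.inner_map_map, PiLp.inner_apply]
  refine Finset.sum_congr rfl fun i _ => ?_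
  have := hs.eigenvectorBasis_apply_self_apply rfl x i
  rw [LinearMap.comp_apply] at this
  rw [this]
  simp
  ring

/-- A map without many large singular values is small on a subspace of small codimension. -/
lemma exists_small_of_not_robustRank (T : X →ₗ[ℝ] Y) (E : Submodule ℝ Y) {r : ℕ} {ε : ℝ}
    (hε : 0 < ε) (h : ¬ RobustRank T E r ε) :
    ∃ Z : Submodule ℝ X, Module.finrank ℝ X + 1 ≤ Module.finrank ℝ Z + r ∧
      ∀ x ∈ Z, x ≠ 0 → ∃ e ∈ E, ‖T x + e‖ < ε * ‖x‖ := by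
  classical
  let B : X →ₗ[ℝ] Y := Eᗮ.starProjection.toLinearMap ∘ₗ T
  let b := B.isSymmetric_adjoint_comp_self.eigenvectorBasis rfl
  let l := B.isSymmetric_adjoint_comp_self.eigenvalues rfl
  have hB : ∀ x, ‖B x‖ ^ 2 = ∑ i, l i * b.repr x i ^ 2 := B.norm_sq_apply_eq_sum_eigenvalues
  -- The span of these eigenvectors would witness robust rank `S.card`, so `S.card < r`; the
  -- complementary eigenvectors span `Z`.
  let S : Finset (Fin (Module.finrank ℝ X)) := Finset.univ.filter fun i => ε ^ 2 ≤ l i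
  refine ⟨Submodule.span ℝ (b '' (Sᶜ : Finset _)), ?_, ?_⟩
  · rw [b.finrank_span_image, Finset.card_compl, Fintype.card_fin]
    have h1 : S.card ≤ Module.finrank ℝ X := by simpa using Finset.card_le_univ S
    have : S.card < r := by
      by_contra! hr
      refine h ⟨Submodule.span ℝ (b '' S), by rwa [b.finrank_span_image], fun x hx e he => ?_⟩
      refine le_trans ?_ (norm_starProjection_orthogonal_le E (T x) e he)
      refine le_of_sq_le_sq ?_ (norm_nonneg _)
      change _ ≤ ‖B x‖ ^ 2
      rw [hB, mul_pow, b.norm_sq_eq_sum_repr_sq, Finset.mul_sum]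
      refine Finset.sum_le_sum fun i _ => ?_
      by_cases hi : i ∈ S
      · exact mul_le_mul_of_nonneg_right (Finset.mem_filter.1 hi).2 (sq_nonneg _)
      · rw [b.repr_eq_zero_of_mem_span hx hi]
        simp
    omega
  · intro x hx hx0
    obtain ⟨e, he, hxe⟩ := exists_starProjection_orthogonal_eq_add E (T x)
    refine ⟨e, he, ?_⟩
    rw [← hxe]
    refine lt_of_pow_lt_pow_left₀ 2 (by positivity) ?_
    change ‖B x‖ ^ 2 < _
    have hx1 : ∃ i, b.repr x i ≠ 0 := by
      by_contra! h0
      have := b.norm_sq_eq_sum_repr_sq x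
      simp [h0] at this
      exact hx0 this
    obtain ⟨i, hi⟩ := hx1
    have hS : ∀ i, b.repr x i ≠ 0 → l i < ε ^ 2 := by
      intro i hi
      by_contra! hl
      exact hi (b.repr_eq_zero_of_mem_span hx (by simpa [S] using hl))
    rw [hB, mul_pow, b.norm_sq_eq_sum_repr_sq, Finset.mul_sum]
    refine Finset.sum_lt_sum (fun i _ => ?_) ⟨i, Finset.mem_univ i, ?_⟩
    · by_cases hi : b.repr x i = 0
      · simp [hi]
      · exact mul_le_mul_of_nonneg_right (hS i hi).le (sq_nonneg _)
    · exact mul_lt_mul_of_pos_right (hS i hi) (by positivity)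

/-- If the `r`-th largest singular value is at least `θ`, then at least `r` of them are. -/
lemma robustRank_of_le_singularValues (T : X →ₗ[ℝ] Y) {r : ℕ} {θ : ℝ} (hr : 0 < r) (hθ : 0 < θ)
    (h : θ ≤ T.singularValues (r - 1)) : RobustRank T ⊥ r θ := by
  have hrn : r - 1 < Module.finrank ℝ X := by
    by_contra! h0
    rw [T.singularValues_of_finrank_le h0] at h
    linarith
  let b := T.isSymmetric_adjoint_comp_self.eigenvectorBasis rfl
  let S : Finset (Fin (Module.finrank ℝ X)) := Finset.Iic ⟨r - 1, hrn⟩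
  refine ⟨Submodule.span ℝ (b '' S), ?_, fun x hx e he => ?_⟩
  · rw [b.finrank_span_image, Fin.card_Iic]
    simp only
    omega
  · rw [(Submodule.mem_bot ℝ).1 he, add_zero]
    refine le_of_sq_le_sq ?_ (norm_nonneg _)
    rw [T.norm_sq_apply_eq_sum_eigenvalues, mul_pow, b.norm_sq_eq_sum_repr_sq, Finset.mul_sum]
    refine Finset.sum_le_sum fun i _ => ?_
    by_cases hi : i ∈ S
    · refine mul_le_mul_of_nonneg_right ?_ (sq_nonneg _)
      rw [← T.sq_singularValues_fin rfl i]
      have hir : i ≤ ⟨r - 1, hrn⟩ := Finset.mem_Iic.1 hi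
      have := T.singularValues_antitone (show (i : ℕ) ≤ r - 1 from hir)
      gcongr
      linarith
    · rw [b.repr_eq_zero_of_mem_span hx hi]
      simp

/-- A lower bound for the map is a lower bound for its smallest singular value. -/
lemma RobustRank.le_singularValues {T : X →ₗ[ℝ] Y} {E : Submodule ℝ Y} {r : ℕ} {θ : ℝ}
    (h : RobustRank T E r θ) (hr : r = Module.finrank ℝ X) (hr0 : 0 < r) :
    θ ≤ T.singularValues (r - 1) := by
  obtain ⟨W, hW, h⟩ := h
  have hWt : W = ⊤ :=
    Submodule.eq_top_of_finrank_eq (le_antisymm (Submodule.finrank_le W) (hr ▸ hW))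
  have hrn : r - 1 < Module.finrank ℝ X := by omega
  let b := T.isSymmetric_adjoint_comp_self.eigenvectorBasis rfl
  -- As `W` is the whole space, the bound can be tested on the right singular vector of the smallest
  -- singular value.
  have h1 := h (b ⟨r - 1, hrn⟩) (by simp [hWt]) 0 E.zero_mem
  rw [add_zero, b.orthonormal.1, mul_one] at h1
  refine h1.trans (le_of_sq_le_sq ?_ (T.singularValues_nonneg _))
  rw [T.norm_sq_apply_eq_sum_eigenvalues, T.sq_singularValues_of_lt rfl hrn]
  change ∑ i, _ * b.repr (b ⟨r - 1, hrn⟩) i ^ 2 ≤ _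
  rw [b.repr_self]
  simp [ite_pow]

/-- A linear map to a space of small dimension has a large kernel on every subspace. -/
lemma le_finrank_inf_ker {V : Type*} [AddCommGroup V] [Module ℝ V] [FiniteDimensional ℝ V]
    (W : Submodule ℝ X) (L : X →ₗ[ℝ] V) :
    Module.finrank ℝ W - Module.finrank ℝ V ≤ Module.finrank ℝ ↥(W ⊓ LinearMap.ker L) := by
  have h1 := (L.domRestrict W).finrank_range_add_finrank_ker
  have h2 := Submodule.finrank_le (LinearMap.range (L.domRestrict W))
  have h3 : Module.finrank ℝ (LinearMap.ker (L.domRestrict W)) =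
      Module.finrank ℝ ↥(W ⊓ LinearMap.ker L) := by
    have h4 : (LinearMap.ker (L.domRestrict W)).map W.subtype = W ⊓ LinearMap.ker L := by
      ext x
      simp [LinearMap.domRestrict_apply, and_comm]
    rw [← h4, Submodule.finrank_map_subtype_eq]
  omega

/-- Passing to the quotient by a subspace `F` destroys at most `dim F` large singular values. -/
lemma RobustRank.sup {T : X →ₗ[ℝ] Y} {E : Submodule ℝ Y} {R : ℕ} {θ : ℝ}
    (h : RobustRank T E R θ) (F : Submodule ℝ Y) :
    RobustRank T (E ⊔ F) (R - Module.finrank ℝ F) θ := by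
  obtain ⟨W, hW, h⟩ := h
  let Q := Eᗮ.starProjection
  let F' : Submodule ℝ Y := F.map Q.toLinearMap
  have hF' : Module.finrank ℝ F' ≤ Module.finrank ℝ F := Submodule.finrank_map_le _ _
  -- On the kernel of `L`, the vector `Q (T x)` is orthogonal to `F'`, so by Pythagoras adding
  -- elements of `F` cannot shorten it.
  let L : X →ₗ[ℝ] F' := F'.orthogonalProjectionOnto.toLinearMap ∘ₗ Q.toLinearMap ∘ₗ T
  refine ⟨W ⊓ LinearMap.ker L, ?_, ?_⟩
  · have := le_finrank_inf_ker W L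
    omega
  · rintro x ⟨hxW, hxL⟩ e he
    obtain ⟨a, ha, f, hf, rfl⟩ := Submodule.mem_sup.1 he
    obtain ⟨a', ha', hQ⟩ := exists_starProjection_orthogonal_eq_add E (T x)
    have h1 : θ * ‖x‖ ≤ ‖Q (T x)‖ := by
      have := h x hxW a' ha'
      rwa [← hQ] at this
    have hort : Q (T x) ∈ F'ᗮ := by
      have : L x = 0 := hxL
      simpa [L] using this
    have h2 : ‖Q (T x)‖ ≤ ‖Q (T x) + Q f‖ := by
      have h0 : inner ℝ (Q (T x)) (Q f) = 0 :=
        Submodule.inner_left_of_mem_orthogonal (K := F') (Submodule.mem_map_of_mem hf) hort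
      refine le_of_sq_le_sq ?_ (norm_nonneg _)
      rw [norm_add_sq_real, h0]
      nlinarith [sq_nonneg ‖Q f‖]
    have h3 := norm_starProjection_orthogonal_le E (T x + f) a ha
    rw [map_add] at h3
    calc θ * ‖x‖ ≤ _ := h1
      _ ≤ _ := h2
      _ ≤ _ := h3
      _ = _ := by congr 1; abel

/-- Of two maps that differ by a large multiple of a map with many large singular values, one has
many large singular values. -/
lemma RobustRank.add_smul_or {A : X →ₗ[ℝ] Y} {E : Submodule ℝ Y} {r r' : ℕ} {θ ε : ℝ}
    (h : RobustRank A E r θ) (hr : 2 * r' ≤ r + 1) (hε : 0 < ε) (T : X →ₗ[ℝ] Y) {a b : ℝ}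
    (hab : 2 * ε ≤ |a - b| * θ) :
    RobustRank (T + a • A) E r' ε ∨ RobustRank (T + b • A) E r' ε := by
  by_contra! hc
  obtain ⟨Za, hZa, ha⟩ := exists_small_of_not_robustRank _ E hε hc.1
  obtain ⟨Zb, hZb, hb⟩ := exists_small_of_not_robustRank _ E hε hc.2
  obtain ⟨W, hW, h⟩ := h
  have h1 := Submodule.finrank_quotient_add_finrank Za
  have h2 := Submodule.finrank_quotient_add_finrank Zb
  -- `Za` and `Zb` have codimension at most `r' - 1`, and `2 * (r' - 1) < r`, so some nonzero `x` in
  -- `W` lies in both. There the two maps are too small for their difference `(a - b) • A x`.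
  have h3 := le_finrank_inf_ker W (Za.mkQ.prod Zb.mkQ)
  rw [Module.finrank_prod] at h3
  have h4 : 0 < Module.finrank ℝ ↥(W ⊓ LinearMap.ker (Za.mkQ.prod Zb.mkQ)) := by
    omega
  obtain ⟨x, hx, hx0⟩ := (Submodule.ne_bot_iff _).1 (Submodule.one_le_finrank_iff.1 h4)
  obtain ⟨hxW, hxk⟩ := hx
  simp only [LinearMap.ker_prod, Submodule.ker_mkQ, Submodule.mem_inf, SetLike.mem_coe] at hxk
  obtain ⟨e, he, hae⟩ := ha x hxk.1 hx0
  obtain ⟨e', he', hbe⟩ := hb x hxk.2 hx0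
  have hd : (T + a • A) x + e - ((T + b • A) x + e') = (a - b) • A x + (e - e') := by
    simp [sub_smul]; abel
  have hne : a - b ≠ 0 := by
    intro h0
    rw [h0] at hab
    simp at hab
    linarith
  have h5 : (a - b) • A x + (e - e') = (a - b) • (A x + (a - b)⁻¹ • (e - e')) := by
    rw [smul_add, smul_inv_smul₀ hne]
  have h6 := h x hxW _ (E.smul_mem (a - b)⁻¹ (E.sub_mem he he'))
  have h7 := norm_sub_le ((T + a • A) x + e) ((T + b • A) x + e')
  rw [hd, h5, norm_smul, Real.norm_eq_abs] at h7
  have h8 := mul_le_mul_of_nonneg_left h6 (abs_nonneg (a - b))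
  have h9 := mul_le_mul_of_nonneg_right hab (norm_nonneg x)
  nlinarith

end RobustRank

/-! ### Block maps -/

/-- The linear map with columns `F k`. -/
noncomputable def comb {κ Y : Type*} [Fintype κ] [AddCommGroup Y] [Module ℝ Y] (F : κ → Y) :
    EuclideanSpace ℝ κ →ₗ[ℝ] Y :=
  Fintype.linearCombination ℝ F ∘ₗ (WithLp.linearEquiv 2 ℝ (κ → ℝ)).toLinearMap

section comb

variable {ι κ Y : Type*} [Fintype ι] [Fintype κ] [NormedAddCommGroup Y] [InnerProductSpace ℝ Y]
  [FiniteDimensional ℝ Y]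

omit [FiniteDimensional ℝ Y] in
lemma comb_apply (F : κ → Y) (x : EuclideanSpace ℝ κ) : comb F x = ∑ k, x k • F k := by
  simp [comb, Fintype.linearCombination_apply]

/-- The slice `x (i, ·)`. -/
def slice (i : ι) : EuclideanSpace ℝ (ι × κ) →ₗ[ℝ] EuclideanSpace ℝ κ where
  toFun x := WithLp.toLp 2 fun k => x (i, k)
  map_add' x y := by ext; simp
  map_smul' a x := by ext; simp

lemma norm_sq_eq_sum_slice (x : EuclideanSpace ℝ (ι × κ)) :
    ‖x‖ ^ 2 = ∑ i, ‖slice i x‖ ^ 2 := by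
  simp [EuclideanSpace.norm_sq_eq, slice, Fintype.sum_prod_type]

omit [FiniteDimensional ℝ Y] in
lemma comb_uncurry_apply (F : ι → κ → Y) (x : EuclideanSpace ℝ (ι × κ)) :
    comb (Function.uncurry F) x = ∑ i, comb (F i) (slice i x) := by
  simp [comb_apply, slice, Fintype.sum_prod_type]

/-- If a block matrix has many large singular values, so has one of its blocks. -/
lemma RobustRank.exists_block {F : ι → κ → Y} {E : Submodule ℝ Y} {R r : ℕ} {θ : ℝ} (hθ : 0 < θ)
    (h : RobustRank (comb (Function.uncurry F)) E R θ) (hr : Fintype.card ι * (r - 1) < R) :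
    ∃ i, RobustRank (comb (F i)) E r (θ / √(Fintype.card ι)) := by
  classical
  obtain ⟨W, hW, h⟩ := h
  have hι : 0 < Fintype.card ι := by
    by_contra! h0
    have h1 := Submodule.finrank_le W
    rw [finrank_euclideanSpace, Fintype.card_prod, Nat.le_zero.1 h0, zero_mul] at h1
    omega
  have hn : 0 < √(Fintype.card ι : ℝ) := by positivity
  by_contra! hc
  choose Z hZ hs using fun i => exists_small_of_not_robustRank _ E (by positivity) (hc i)
  -- Requiring every slice to lie in its `Z i` imposes fewer than `R` linear conditions, so some
  -- nonzero `x` in `W` meets them all.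
  have h3 := le_finrank_inf_ker W (LinearMap.pi fun i => (Z i).mkQ ∘ₗ slice i)
  have h4 : Module.finrank ℝ ((i : ι) → EuclideanSpace ℝ κ ⧸ Z i) ≤
      Fintype.card ι * (r - 1) := by
    rw [Module.finrank_pi_fintype, ← smul_eq_mul, ← Finset.card_univ]
    refine Finset.sum_le_card_nsmul _ _ _ fun i _ => ?_
    have := Submodule.finrank_quotient_add_finrank (Z i)
    have := hZ i
    omega
  have h5 := (Nat.sub_pos_of_lt ((h4.trans_lt hr).trans_le hW)).trans_le h3
  obtain ⟨x, ⟨hxW, hxk⟩, hx0⟩ := (Submodule.ne_bot_iff _).1 (Submodule.one_le_finrank_iff.1 h5)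
  have hxZ : ∀ i, slice i x ∈ Z i := by
    intro i
    have := congrFun (LinearMap.mem_ker.1 hxk) i
    simpa using this
  have hsm : ∀ i, ∃ e ∈ E, ‖comb (F i) (slice i x) + e‖ ≤
      θ / √(Fintype.card ι) * ‖slice i x‖ ∧ (slice i x ≠ 0 → ‖comb (F i) (slice i x) + e‖ <
      θ / √(Fintype.card ι) * ‖slice i x‖) := by
    intro i
    by_cases h0 : slice i x = 0
    · exact ⟨0, E.zero_mem, by simp [h0], fun h => absurd h0 h⟩
    · obtain ⟨e, he, hlt⟩ := hs i _ (hxZ i) h0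
      exact ⟨e, he, hlt.le, fun _ => hlt⟩
  choose e he hle hlt using hsm
  have hex : ∃ i, slice i x ≠ 0 := by
    by_contra! h0
    have := norm_sq_eq_sum_slice x
    simp [h0] at this
    exact hx0 this
  have h6 : ‖comb (Function.uncurry F) x + ∑ i, e i‖ < θ / √(Fintype.card ι) * ∑ i, ‖slice i x‖ := by
    rw [comb_uncurry_apply, ← Finset.sum_add_distrib, Finset.mul_sum]
    refine (norm_sum_le _ _).trans_lt ?_
    obtain ⟨i, hi⟩ := hex
    exact Finset.sum_lt_sum (fun i _ => hle i) ⟨i, Finset.mem_univ i, hlt i hi⟩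
  have h7 := h x hxW (∑ i, e i) (E.sum_mem fun i _ => he i)
  -- Cauchy–Schwarz; the loss of `√(Fintype.card ι)` in the statement arises here.
  have h8 : ∑ i, ‖slice i x‖ ≤ √(Fintype.card ι) * ‖x‖ := by
    refine le_of_sq_le_sq ?_ (by positivity)
    rw [mul_pow, Real.sq_sqrt (by positivity), norm_sq_eq_sum_slice]
    simpa using sq_sum_le_card_mul_sum_sq (s := Finset.univ) (f := fun i => ‖slice i x‖)
  have h9 : θ / √(Fintype.card ι) * ∑ i, ‖slice i x‖ ≤ θ * ‖x‖ := by
    calc _ ≤ θ / √(Fintype.card ι) * (√(Fintype.card ι) * ‖x‖) := by gcongr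
      _ = _ := by field_simp
  linarith

end comb

/-! ### Probability estimates in one coordinate -/

/-- If `S ⊆ G`, where `G` does not depend on the coordinate `i`, and if the sections of `S` along
the coordinate `i` have measure at most `q`, then the measure of `S` is at most `q` times that of
`G`. -/
lemma pi_measure_le_mul_of_section_le {ι : Type*} [Fintype ι] [DecidableEq ι] {X : ι → Type*}
    [∀ i, MeasurableSpace (X i)] {μ : ∀ i, Measure (X i)} [∀ i, IsProbabilityMeasure (μ i)]
    {S G : Set (∀ i, X i)} (hS : MeasurableSet S) (hG : MeasurableSet G) (hSG : S ⊆ G) (i : ι)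
    (hGi : ∀ x t, Function.update x i t ∈ G → x ∈ G) {q : ENNReal}
    (hq : ∀ x, μ i {t | Function.update x i t ∈ S} ≤ q) :
    Measure.pi μ S ≤ q * Measure.pi μ G := by
  rw [← lintegral_indicator_one hS, ← lintegral_indicator_one hG,
    ← lintegral_const_mul _ (measurable_one.indicator hG)]
  refine lintegral_le_of_lmarginal_le {i} (measurable_one.indicator hS)
    ((measurable_one.indicator hG).const_mul q) ?_
  rw [lmarginal_singleton, lmarginal_singleton]
  intro x
  have h1 : ∀ T : Set (∀ i, X i), MeasurableSet T →
      ∫⁻ t, T.indicator 1 (Function.update x i t) ∂μ i = μ i {t | Function.update x i t ∈ T} := by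
    intro T hT
    have hm : MeasurableSet {t | Function.update x i t ∈ T} := measurable_update x hT
    rw [← lintegral_indicator_one hm]
    rfl
  have hm : Measurable fun t => G.indicator (1 : (∀ i, X i) → ENNReal) (Function.update x i t) :=
    (measurable_one.indicator hG).comp (measurable_update x)
  simp only
  rw [lintegral_const_mul _ hm, h1 S hS, h1 G hG]
  -- The whole fibre through a point of `G` lies in `G`, and the fibre through any other point
  -- misses `S`.
  by_cases hx : x ∈ G
  · have : {t | Function.update x i t ∈ G} = Set.univ := by
      refine Set.eq_univ_of_forall fun t => hGi _ (x i) ?_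
      simpa using hx
    rw [this, measure_univ, mul_one]
    exact hq x
  · have : {t | Function.update x i t ∈ S} = ∅ := by
      refine Set.eq_empty_of_forall_notMem fun t ht => hx (hGi x t (hSG ht))
    simp [this]

/-- A Gaussian variable is unlikely to lie in a set of small diameter. -/
lemma gaussianReal_le_of_diam_le {μ ρ ℓ : ℝ} (hρ : 0 < ρ) {S : Set ℝ}
    (hS : ∀ a ∈ S, ∀ b ∈ S, |a - b| ≤ ℓ) :
    gaussianReal μ (ρ ^ 2).toNNReal S ≤ ENNReal.ofReal (ℓ / (2 * ρ)) := by
  have hv : (ρ ^ 2).toNNReal ≠ 0 := by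
    rw [ne_eq, Real.toNNReal_eq_zero]
    exact not_le.2 (by positivity)
  have hpdf : ∀ x, gaussianPDF μ (ρ ^ 2).toNNReal x ≤ ENNReal.ofReal (1 / (2 * ρ)) := by
    intro x
    refine ENNReal.ofReal_le_ofReal ?_
    rw [gaussianPDFReal, Real.coe_toNNReal _ (sq_nonneg ρ)]
    have h1 : 2 * ρ ≤ √(2 * Real.pi * ρ ^ 2) := by
      refine Real.le_sqrt_of_sq_le ?_
      nlinarith [Real.pi_gt_three, sq_nonneg ρ]
    have h2 : Real.exp (-(x - μ) ^ 2 / (2 * ρ ^ 2)) ≤ 1 := by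
      rw [Real.exp_le_one_iff]
      exact div_nonpos_of_nonpos_of_nonneg (by nlinarith [sq_nonneg (x - μ)]) (by positivity)
    calc _ ≤ (√(2 * Real.pi * ρ ^ 2))⁻¹ * 1 := by gcongr
      _ ≤ (2 * ρ)⁻¹ * 1 := by gcongr
      _ = _ := by ring
  have hvol : volume S ≤ ENNReal.ofReal ℓ := by
    refine (Real.volume_le_diam S).trans (Metric.ediam_le fun a ha b hb => ?_)
    rw [edist_dist, Real.dist_eq]
    exact ENNReal.ofReal_le_ofReal (hS a ha b hb)
  rw [gaussianReal_apply _ hv]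
  calc _ ≤ ∫⁻ _ in S, ENNReal.ofReal (1 / (2 * ρ)) := lintegral_mono fun x => hpdf x
    _ = ENNReal.ofReal (1 / (2 * ρ)) * volume S := by rw [setLIntegral_const]
    _ ≤ ENNReal.ofReal (1 / (2 * ρ)) * ENNReal.ofReal ℓ := by gcongr
    _ = _ := by
      rw [← ENNReal.ofReal_mul (by positivity)]
      congr 1
      ring

/-! ### Closedness, hence measurability, of robust rank -/

section closed

variable {κ κ' Y : Type*} [Fintype κ] [Fintype κ'] [NormedAddCommGroup Y] [InnerProductSpace ℝ Y]
  [FiniteDimensional ℝ Y]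

omit [FiniteDimensional ℝ Y] in
/-- Having at least `r` large singular values is a closed condition. -/
lemma isClosed_robustRank (r : ℕ) (θ : ℝ) :
    IsClosed {p : (κ → Y) × (κ' → Y) |
      RobustRank (comb p.1) (Submodule.span ℝ (Set.range p.2)) r θ} := by
  -- The witness `W` is replaced by an orthonormal `r`-frame. Frames form a compact space, so the
  -- closed set `C` below keeps a closed image when the frame is forgotten.
  let K : Set (Fin r → EuclideanSpace ℝ κ) := {w | Orthonormal ℝ w}
  have hK : IsCompact K := by
    refine (isCompact_univ_pi fun _ : Fin r =>
      isCompact_closedBall (0 : EuclideanSpace ℝ κ) 1).of_isClosed_subset ?_ ?_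
    · simp only [K, orthonormal_iff_ite, Set.ofPred_forall]
      refine isClosed_iInter fun i => isClosed_iInter fun j => ?_
      exact isClosed_eq (by fun_prop) (by fun_prop)
    · intro w hw i _
      simp [hw.1 i]
  have : CompactSpace K := isCompact_iff_compactSpace.1 hK
  let C : Set (((κ → Y) × (κ' → Y)) × K) := {p | ∀ (c : EuclideanSpace ℝ (Fin r)) (y : κ' → ℝ),
    θ * ‖c‖ ≤ ‖∑ k, (∑ i, c i • p.2.1 i) k • p.1.1 k + ∑ k, y k • p.1.2 k‖}
  have hC : IsClosed C := by
    simp only [C, Set.ofPred_forall]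
    refine isClosed_iInter fun c => isClosed_iInter fun y => ?_
    have h1 : ∀ k, Continuous fun w : K => (∑ i, c i • w.1 i) k := fun k =>
      (EuclideanSpace.proj (𝕜 := ℝ) k).continuous.comp (continuous_finsetSum _ fun i _ =>
        ((continuous_apply i).comp continuous_subtype_val).const_smul (c i))
    have h2 : Continuous fun p : ((κ → Y) × (κ' → Y)) × K =>
        ∑ k, (∑ i, c i • p.2.1 i) k • p.1.1 k :=
      continuous_finsetSum _ fun k _ => ((h1 k).comp continuous_snd).smul
        ((continuous_apply k).comp (continuous_fst.comp continuous_fst))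
    have h3 : Continuous fun p : ((κ → Y) × (κ' → Y)) × K => ∑ k, y k • p.1.2 k :=
      continuous_finsetSum _ fun k _ =>
        ((continuous_apply k).comp (continuous_snd.comp continuous_fst)).const_smul (y k)
    exact isClosed_le continuous_const (h2.add h3).norm
  have hnorm : ∀ w ∈ K, ∀ c : EuclideanSpace ℝ (Fin r), ‖∑ i, c i • w i‖ = ‖c‖ := by
    intro w hw c
    refine (sq_eq_sq₀ (norm_nonneg _) (norm_nonneg _)).1 ?_
    rw [← real_inner_self_eq_norm_sq, hw.inner_sum, EuclideanSpace.norm_sq_eq]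
    simp [sq]
  convert isClosedMap_fst_of_compactSpace _ hC using 1
  ext ⟨F, G⟩
  simp only [Set.mem_ofPred_eq, Set.mem_image, Prod.exists, exists_and_right, exists_eq_right,
    Subtype.exists, C]
  constructor
  · rintro ⟨W, hW, h⟩
    let b := stdOrthonormalBasis ℝ W
    let w : Fin r → EuclideanSpace ℝ κ := fun i => b (Fin.castLE hW i)
    have hw : Orthonormal ℝ w :=
      (b.orthonormal.comp_linearIsometry W.subtypeₗᵢ).comp _ (Fin.castLE_injective hW)
    refine ⟨w, hw, fun c y => ?_⟩
    have h1 := h (∑ i, c i • w i)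
      (W.sum_mem fun i _ => W.smul_mem _ (b (Fin.castLE hW i)).2) (∑ k, y k • G k)
      (Submodule.sum_mem _ fun k _ => Submodule.smul_mem _ _ (Submodule.subset_span ⟨k, rfl⟩))
    rwa [hnorm w hw, comb_apply] at h1
  · rintro ⟨w, hw, h⟩
    refine ⟨Submodule.span ℝ (Set.range w), ?_, ?_⟩
    · rw [finrank_span_eq_card hw.linearIndependent, Fintype.card_fin]
    · intro x hx e he
      obtain ⟨c, rfl⟩ := (Submodule.mem_span_range_iff_exists_fun ℝ).1 hx
      obtain ⟨y, rfl⟩ := (Submodule.mem_span_range_iff_exists_fun ℝ).1 he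
      have := h (WithLp.toLp 2 c) y
      rw [← hnorm w hw] at this
      rw [comb_apply]
      exact this

end closed

/-! ### Contraction of one index with one random vector -/

/-- The contraction of the first index of the family `F` with the vector `v`. -/
noncomputable def contractFst {ι κ Y : Type*} [Fintype ι] [AddCommGroup Y] [Module ℝ Y]
    (v : ι → ℝ) (F : ι → κ → Y) : κ → Y :=
  fun k => ∑ i, v i • F i k

section contractFst

variable {ι κ Y : Type*} [Fintype ι] [Fintype κ] [NormedAddCommGroup Y] [InnerProductSpace ℝ Y]
  [FiniteDimensional ℝ Y]

-- The contraction is affine in each coordinate of `z`, with slope the corresponding block: the form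
-- required by `RobustRank.add_smul_or`.
omit [FiniteDimensional ℝ Y] in
lemma comb_contractFst_update [DecidableEq ι] (F : ι → κ → Y) (u z : ι → ℝ) (i : ι) (t : ℝ) :
    comb (contractFst (u + Function.update z i t) F) =
      comb (contractFst (u + Function.update z i 0) F) + t • comb (F i) := by
  ext x
  simp only [LinearMap.add_apply, LinearMap.smul_apply, comb_apply, contractFst, Finset.smul_sum,
    ← Finset.sum_add_distrib]
  refine Finset.sum_congr rfl fun k _ => ?_
  rw [← smul_comm (x k) t, ← Finset.smul_sum, ← Finset.smul_sum, ← smul_add]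
  congr 1
  rw [← Finset.add_sum_erase _ _ (Finset.mem_univ i), ← Finset.add_sum_erase _ (fun j =>
    (u + Function.update z i 0) j • F j k) (Finset.mem_univ i), Finset.sum_congr rfl
    (g := fun j => (u + Function.update z i 0) j • F j k) (fun j hj => by
      simp [Finset.ne_of_mem_erase hj])]
  simp only [Pi.add_apply, Function.update_self, add_zero, add_smul]
  abel

omit [Fintype κ] [FiniteDimensional ℝ Y] in
lemma continuous_contractFst : Continuous fun p : (ι → ℝ) × (ι → κ → Y) => contractFst p.1 p.2 := by
  unfold contractFst
  fun_prop

lemma isClosed_robustRank_contractFst (F : ι → κ → Y) (u : ι → ℝ) (E : Submodule ℝ Y) (r : ℕ)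
    (θ : ℝ) : IsClosed {z : ι → ℝ | RobustRank (comb (contractFst (u + z) F)) E r θ} := by
  obtain ⟨s, rfl⟩ := (inferInstance : IsNoetherian ℝ Y).noetherian E
  have h := (isClosed_robustRank (κ := κ) (κ' := s) (Y := Y) r θ).preimage
    (f := fun z : ι → ℝ => (contractFst (u + z) F, Subtype.val))
    ((continuous_contractFst.comp (by fun_prop : Continuous fun z : ι → ℝ => (u + z, F))).prodMk
      continuous_const)
  simpa using h

/-- A random contraction of a single index keeps a constant proportion of the large singular
values, except with exponentially small probability. -/
lemma measure_not_robustRank_contractFst_le (F : ι → κ → Y) (u : ι → ℝ) {ρ θ : ℝ} (hρ : 0 < ρ)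
    (hθ : 0 < θ) {r r' : ℕ} (hr : 2 * r' ≤ r + 1) (k : ℕ) (E : Submodule ℝ Y) (R : ℕ)
    (h : RobustRank (comb (Function.uncurry F)) E R θ)
    (hR : Fintype.card ι * (r - 1) + k * Fintype.card κ < R + Fintype.card κ) :
    Measure.pi (fun _ : ι => gaussianReal 0 (ρ ^ 2).toNNReal)
      {z | ¬ RobustRank (comb (contractFst (u + z) F)) E r' (ρ * θ / (4 * √(Fintype.card ι)))} ≤
      ENNReal.ofReal (1 / 4) ^ k := by
  classical
  -- Each step uses up one coordinate and one quotient. No quotient has to be affordable after the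
  -- last choice of a block, whence the extra `Fintype.card κ` on the right of `hR`.
  induction k generalizing E R with
  | zero => simpa using prob_le_one
  | succ k ih =>
    have hlt : Fintype.card ι * (r - 1) + k * Fintype.card κ < R := by
      rw [add_mul] at hR
      omega
    obtain ⟨i, hi⟩ := h.exists_block (r := r) hθ (by omega)
    have hι : 0 < √(Fintype.card ι : ℝ) :=
      Real.sqrt_pos.2 (Nat.cast_pos.2 (Fintype.card_pos_iff.2 ⟨i⟩))
    have hF : Module.finrank ℝ (LinearMap.range (comb (F i))) ≤ Fintype.card κ := by
      simpa using LinearMap.finrank_range_le (comb (F i))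
    have h' : RobustRank (comb (Function.uncurry F)) (E ⊔ LinearMap.range (comb (F i)))
        (R - Fintype.card κ) θ := (h.sup _).mono le_rfl (by omega) le_rfl
    have ih' := ih _ _ h' (by omega)
    rw [pow_succ' (ENNReal.ofReal _)]
    refine le_trans ?_ (mul_le_mul_right ih' _)
    have hmeas := fun E =>
      (isClosed_robustRank_contractFst F u E r' (ρ * θ / (4 * √(Fintype.card ι)))).measurableSet.compl
    refine pi_measure_le_mul_of_section_le (hmeas _) (hmeas _) ?_ i ?_ ?_
    · intro z hz hc
      exact hz (hc.mono le_sup_left le_rfl le_rfl)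
    -- Changing `z i` adds a multiple of `comb (F i)`, which vanishes modulo the enlarged subspace.
    · intro z t hz hc
      refine hz ?_
      obtain ⟨W, hW, hc⟩ := hc
      refine ⟨W, hW, fun x hx e he => ?_⟩
      have := hc x hx (e + (t - z i) • comb (F i) x) (Submodule.add_mem _ he
        (Submodule.smul_mem _ _ (Submodule.mem_sup_right (LinearMap.mem_range_self _ _))))
      convert this using 2
      have h1 := comb_contractFst_update F u z i (z i)
      rw [Function.update_eq_self] at h1
      rw [comb_contractFst_update, h1]
      simp only [LinearMap.add_apply, LinearMap.smul_apply, sub_smul]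
      abel
    · intro z
      -- The bad values of `z i` will be shown to have diameter at most `ρ / 2`.
      have : ENNReal.ofReal (1 / 4) = ENNReal.ofReal ((ρ / 2) / (2 * ρ)) := by
        congr 1
        field_simp
        norm_num
      rw [this]
      refine gaussianReal_le_of_diam_le hρ fun a ha b hb => ?_
      by_contra! hab
      have := hi.add_smul_or hr (ε := ρ * θ / (4 * √(Fintype.card ι))) (by positivity)
        (comb (contractFst (u + Function.update z i 0) F)) (a := a) (b := b) ?_
      · rw [← comb_contractFst_update, ← comb_contractFst_update] at this
        exact this.elim ha hb
      · calc 2 * (ρ * θ / (4 * √(Fintype.card ι))) = ρ / 2 * (θ / √(Fintype.card ι)) := by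
              field_simp
              norm_num
          _ ≤ _ := by gcongr

end contractFst

/-! ### Contraction with one row modulo the other rows -/

/-- The family `G`, together with the contractions of the first index of `F` with all the rows of
`V` but the row `j`. -/
noncomputable def otherContractions {β ι κ κ' Y : Type*} [Fintype ι] [DecidableEq β]
    [AddCommGroup Y] [Module ℝ Y] (V : β → ι → ℝ) (F : ι → κ → Y) (G : κ' → Y) (j : β) :
    κ' ⊕ (β × κ) → Y :=
  Sum.elim G fun p => if p.1 = j then 0 else contractFst (V p.1) F p.2

section otherContractions

variable {β ι κ κ' Y : Type*} [Fintype β] [DecidableEq β] [Fintype ι] [Fintype κ] [Fintype κ']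
  [NormedAddCommGroup Y] [InnerProductSpace ℝ Y] [FiniteDimensional ℝ Y]

omit [Fintype β] [Fintype κ] [Fintype κ'] [FiniteDimensional ℝ Y] in
lemma otherContractions_congr {V V' : β → ι → ℝ} (F : ι → κ → Y) (G : κ' → Y) {j : β}
    (h : ∀ b ≠ j, V b = V' b) : otherContractions V F G j = otherContractions V' F G j := by
  unfold otherContractions
  congr 1
  ext p
  by_cases hp : p.1 = j
  · simp [hp]
  · simp [hp, h p.1 hp]

omit [Fintype β] [Fintype κ] [Fintype κ'] [FiniteDimensional ℝ Y] in
lemma continuous_otherContractions (j : β) :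
    Continuous fun p : (β → ι → ℝ) × (ι → κ → Y) × (κ' → Y) =>
      otherContractions p.1 p.2.1 p.2.2 j := by
  refine continuous_pi fun k => ?_
  rcases k with k | ⟨b, k⟩
  · exact (continuous_apply k).comp (continuous_snd.comp continuous_snd)
  · by_cases hb : b = j
    · simpa [otherContractions, hb] using continuous_const
    · simp only [otherContractions, Sum.elim_inr, hb, if_false]
      have h : Continuous fun p : (β → ι → ℝ) × (ι → κ → Y) × (κ' → Y) => (p.1 b, p.2.1) := by
        fun_prop
      exact (continuous_apply k).comp (continuous_contractFst.comp h)

omit [Fintype β] [Fintype κ] [Fintype κ'] [FiniteDimensional ℝ Y] in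
lemma span_le_span_otherContractions (V : β → ι → ℝ) (F : ι → κ → Y) (G : κ' → Y) (j : β) :
    Submodule.span ℝ (Set.range G) ≤ Submodule.span ℝ (Set.range (otherContractions V F G j)) := by
  refine Submodule.span_mono ?_
  rintro _ ⟨k, rfl⟩
  exact ⟨Sum.inl k, rfl⟩

omit [Fintype β] [Fintype κ] [Fintype κ'] [FiniteDimensional ℝ Y] in
lemma contractFst_mem_span_otherContractions (V : β → ι → ℝ) (F : ι → κ → Y) (G : κ' → Y)
    {j b : β} (hb : b ≠ j) (k : κ) : contractFst (V b) F k ∈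
      Submodule.span ℝ (Set.range (otherContractions V F G j)) :=
  Submodule.subset_span ⟨Sum.inr (b, k), by simp [otherContractions, hb]⟩

omit [Fintype κ'] in
/-- Passing to the quotient by the contractions with all rows but one. -/
lemma RobustRank.otherContractions {T : EuclideanSpace ℝ (ι × κ) →ₗ[ℝ] Y} {G : κ' → Y} {R : ℕ}
    {θ : ℝ} (h : RobustRank T (Submodule.span ℝ (Set.range G)) R θ) (V : β → ι → ℝ)
    (F : ι → κ → Y) (j : β) :
    RobustRank T (Submodule.span ℝ (Set.range (otherContractions V F G j)))
      (R - (Fintype.card β - 1) * Fintype.card κ) θ := by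
  -- The zero entries of `otherContractions` at row `j` do not affect the span; dropping them gives
  -- the count `card β - 1`.
  let H : {b // b ≠ j} × κ → Y := fun p => contractFst (V p.1) F p.2
  refine (h.sup (Submodule.span ℝ (Set.range H))).mono ?_ ?_ le_rfl
  · rw [Submodule.span_le]
    rintro _ ⟨k | ⟨b, k⟩, rfl⟩
    · exact Submodule.mem_sup_left (Submodule.subset_span ⟨k, rfl⟩)
    · by_cases hb : b = j
      · simp [_root_.otherContractions, hb]
      · refine Submodule.mem_sup_right (Submodule.subset_span ⟨(⟨b, hb⟩, k), ?_⟩)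
        simp [_root_.otherContractions, hb, H]
  · have h1 : Module.finrank ℝ (Submodule.span ℝ (Set.range H)) ≤ _ := finrank_range_le_card H
    rw [Fintype.card_prod, Fintype.card_subtype_compl, Fintype.card_subtype_eq] at h1
    omega

lemma measurableSet_robustRank_otherContractions [MeasurableSpace Y] [BorelSpace Y] (j : β) (r : ℕ)
    (θ : ℝ) :
    MeasurableSet {p : (β → ι → ℝ) × (ι → κ → Y) × (κ' → Y) |
      RobustRank (comb (contractFst (p.1 j) p.2.1))
        (Submodule.span ℝ (Set.range (otherContractions p.1 p.2.1 p.2.2 j))) r θ} := by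
  have h := (isClosed_robustRank (κ := κ) (κ' := κ' ⊕ (β × κ)) (Y := Y) r θ).preimage
    ((continuous_contractFst.comp
      (((continuous_apply j).comp continuous_fst).prodMk (continuous_fst.comp continuous_snd) :
        Continuous fun p : (β → ι → ℝ) × (ι → κ → Y) × (κ' → Y) => (p.1 j, p.2.1))).prodMk
      (continuous_otherContractions j))
  exact h.measurableSet

/-- The contraction with a random row keeps a constant proportion of the large singular values,
even modulo the contractions with the other rows. -/
lemma measure_not_robustRank_otherContractions_le [MeasurableSpace Y] [BorelSpace Y]
    {F : ι → κ → Y} {G : κ' → Y} (u : β → ι → ℝ) {ρ θ : ℝ} (hρ : 0 < ρ) (hθ : 0 < θ) {r r' : ℕ}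
    (hr : 2 * r' ≤ r + 1) {k R : ℕ}
    (h : RobustRank (comb (Function.uncurry F)) (Submodule.span ℝ (Set.range G)) R θ)
    (hR : Fintype.card ι * (r - 1) + k * Fintype.card κ +
      (Fintype.card β - 1) * Fintype.card κ < R + Fintype.card κ) (j : β) :
    Measure.pi (fun _ : β => Measure.pi fun _ : ι => gaussianReal 0 (ρ ^ 2).toNNReal)
      {z | ¬ RobustRank (comb (contractFst ((u + z) j) F))
        (Submodule.span ℝ (Set.range (otherContractions (u + z) F G j))) r'
        (ρ * θ / (4 * √(Fintype.card ι)))} ≤ ENNReal.ofReal (1 / 4) ^ k := by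
  have hmeas : MeasurableSet {z : β → ι → ℝ | RobustRank (comb (contractFst ((u + z) j) F))
        (Submodule.span ℝ (Set.range (otherContractions (u + z) F G j))) r'
        (ρ * θ / (4 * √(Fintype.card ι)))} := by
    have hm : Measurable fun z : β → ι → ℝ => (u + z, F, G) :=
      (measurable_const_add u).prodMk measurable_const
    exact hm (measurableSet_robustRank_otherContractions j _ _)
  have := pi_measure_le_mul_of_section_le
    (μ := fun _ : β => Measure.pi fun _ : ι => gaussianReal 0 (ρ ^ 2).toNNReal)
    hmeas.compl MeasurableSet.univ (Set.subset_univ _) j (by simp)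
    (q := ENNReal.ofReal (1 / 4) ^ k) ?_
  · rwa [measure_univ, mul_one] at this
  intro z
  -- The quotient does not involve row `j`, so it stays fixed while that row varies and the estimate
  -- for a single vector applies.
  have hE : ∀ t, otherContractions (u + Function.update z j t) F G j =
      otherContractions (u + z) F G j := fun t =>
    otherContractions_congr F G fun b hb => by simp [hb]
  have := measure_not_robustRank_contractFst_le F (u j) hρ hθ hr k _ _
    (h.otherContractions (u + z) F j) (by omega)
  refine le_trans (measure_mono ?_) this
  intro t ht
  simpa [hE] using ht

omit [FiniteDimensional ℝ Y] in
/-- Blocks that are large modulo the other blocks together form a large map. -/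
lemma robustRank_uncurry_of_forall [Nonempty β] {C : β → κ → Y} {E : Submodule ℝ Y}
    {E' : β → Submodule ℝ Y} {t : ℝ} (ht : 0 ≤ t) (hE : ∀ j, E ≤ E' j)
    (hC : ∀ j b, b ≠ j → ∀ k, C b k ∈ E' j)
    (h : ∀ j, RobustRank (comb (C j)) (E' j) (Fintype.card κ) t) :
    RobustRank (comb (Function.uncurry C)) E (Fintype.card β * Fintype.card κ)
      (t / √(Fintype.card β)) := by
  refine ⟨⊤, by simp, fun x _ e he => ?_⟩
  -- For the largest slice `j`, the contributions of all other blocks lie in `E' j`, so the bound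
  -- for block `j` alone controls the sum.
  obtain ⟨j, -, hj⟩ := Finset.exists_max_image Finset.univ (fun b => ‖slice b x‖)
    Finset.univ_nonempty
  have hx : ‖x‖ ≤ √(Fintype.card β) * ‖slice j x‖ := by
    refine le_of_sq_le_sq ?_ (by positivity)
    rw [mul_pow, Real.sq_sqrt (by positivity), norm_sq_eq_sum_slice, ← nsmul_eq_mul,
      ← Finset.card_univ]
    exact Finset.sum_le_card_nsmul _ _ _ fun b hb => by gcongr; exact hj b hb
  obtain ⟨W, hW, hWj⟩ := h j
  have hWt : W = ⊤ := by
    refine Submodule.eq_top_of_finrank_eq (le_antisymm (Submodule.finrank_le W) ?_)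
    simpa using hW
  have hmem : ∑ b ∈ Finset.univ.erase j, comb (C b) (slice b x) + e ∈ E' j := by
    refine Submodule.add_mem _ (Submodule.sum_mem _ fun b hb => ?_) (hE j he)
    rw [comb_apply]
    exact Submodule.sum_mem _ fun k _ =>
      Submodule.smul_mem _ _ (hC j b (Finset.ne_of_mem_erase hb) k)
  have h1 := hWj (slice j x) (by simp [hWt]) _ hmem
  rw [← add_assoc, Finset.add_sum_erase _ (fun b => comb (C b) (slice b x)) (Finset.mem_univ j), ← comb_uncurry_apply] at h1
  have hβ : 0 < √(Fintype.card β : ℝ) := Real.sqrt_pos.2 (Nat.cast_pos.2 Fintype.card_pos)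
  calc t / √(Fintype.card β) * ‖x‖
      ≤ t / √(Fintype.card β) * (√(Fintype.card β) * ‖slice j x‖) := by gcongr
    _ = t * ‖slice j x‖ := by field_simp
    _ ≤ _ := h1

omit [FiniteDimensional ℝ Y] in
lemma RobustRank.of_comp_equiv {κ₁ : Type*} [Fintype κ₁] (e : κ₁ ≃ κ) {F : κ → Y}
    {E : Submodule ℝ Y} {r : ℕ} {θ : ℝ} (h : RobustRank (comb fun k => F (e k)) E r θ) :
    RobustRank (comb F) E r θ := by
  obtain ⟨W, hW, h⟩ := h
  let L := LinearIsometryEquiv.piLpCongrLeft 2 ℝ ℝ e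
  refine ⟨W.map L.toLinearEquiv.toLinearMap, ?_, ?_⟩
  · rwa [LinearEquiv.finrank_map_eq]
  · rintro _ ⟨x, hx, rfl⟩ a ha
    have h1 := h x hx a ha
    have h2 : comb F (L x) = comb (fun k => F (e k)) x := by
      rw [comb_apply, comb_apply, ← e.sum_comp]
      refine Finset.sum_congr rfl fun k _ => ?_
      simp [L, LinearIsometryEquiv.piLpCongrLeft_apply, Equiv.piCongrLeft'_apply]
    change θ * ‖L x‖ ≤ ‖comb F (L x) + a‖
    rwa [h2, L.norm_map]

end otherContractions

/-! ### Contraction of all indices -/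

/-- The contraction of all the indices of the family `F`, the index `j` with the rows of `V j`. -/
noncomputable def contract {β ι Y : Type*} [Fintype ι] [AddCommGroup Y] [Module ℝ Y] {d : ℕ}
    (V : Fin d → β → ι → ℝ) (F : (Fin d → ι) → Y) : (Fin d → β) → Y :=
  fun J => ∑ I, (∏ j, V j (J j) (I j)) • F I

/-- The family `F`, with its last index made the first of two indices. -/
def splitLast {ι Y : Type*} {d : ℕ} (F : (Fin (d + 1) → ι) → Y) : ι → (Fin d → ι) → Y :=
  fun i I => F (Fin.snoc I i)

section contract

variable {β ι κ Y : Type*} [Fintype β] [DecidableEq β] [Fintype ι] [Fintype κ]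
  [NormedAddCommGroup Y] [InnerProductSpace ℝ Y] [FiniteDimensional ℝ Y]

-- The recursion behind the induction on `d`: peeling off the last index follows the order in which
-- the random matrices are generated.
omit [Fintype β] [DecidableEq β] [FiniteDimensional ℝ Y] in
lemma contract_snoc {d : ℕ} (V : Fin (d + 1) → β → ι → ℝ) (F : (Fin (d + 1) → ι) → Y)
    (J : Fin d → β) (b : β) :
    contract V F (Fin.snoc J b) =
      contract (fun j => V j.castSucc) (contractFst (V (Fin.last d) b) (splitLast F)) J := by
  simp only [contract, contractFst, splitLast, Finset.smul_sum]
  rw [← (Fin.snocEquiv fun _ => ι).sum_comp, Fintype.sum_prod_type, Finset.sum_comm]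
  refine Finset.sum_congr rfl fun I _ => Finset.sum_congr rfl fun i _ => ?_
  rw [Fin.prod_univ_castSucc, smul_smul]
  simp [Fin.snocEquiv]

omit [Fintype β] [DecidableEq β] [FiniteDimensional ℝ Y] in
lemma contract_mem_span {d : ℕ} (V : Fin d → β → ι → ℝ) (F : (Fin d → ι) → Y) (J : Fin d → β)
    {E : Submodule ℝ Y} (h : ∀ I, F I ∈ E) : contract V F J ∈ E :=
  Submodule.sum_mem _ fun I _ => Submodule.smul_mem _ _ (h I)

omit [Fintype β] [DecidableEq β] [FiniteDimensional ℝ Y] in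
lemma RobustRank.contract_zero [Fintype β] {V : Fin 0 → β → ι → ℝ} {F : (Fin 0 → ι) → Y}
    {E : Submodule ℝ Y} {R : ℕ} {θ : ℝ} (h : RobustRank (comb F) E R θ) :
    RobustRank (comb (contract V F)) E R θ := by
  refine RobustRank.of_comp_equiv (Equiv.ofUnique (Fin 0 → ι) (Fin 0 → β)) ?_
  convert h using 2
  ext I
  rw [Subsingleton.elim I default]
  simp [contract]

omit [Fintype κ] [FiniteDimensional ℝ Y] in
/-- If for every row of the last matrix the contraction of the other indices is large modulo the
other rows, then the contraction of all the indices is large. -/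
lemma robustRank_contract_succ [Nonempty β] {d : ℕ} (V : Fin (d + 1) → β → ι → ℝ)
    (F : (Fin (d + 1) → ι) → Y) (G : κ → Y) {t : ℝ} (ht : 0 ≤ t)
    (h : ∀ b, RobustRank (comb (contract (fun j => V j.castSucc)
      (contractFst (V (Fin.last d) b) (splitLast F))))
      (Submodule.span ℝ (Set.range (otherContractions (V (Fin.last d)) (splitLast F) G b)))
      (Fintype.card β ^ d) t) :
    RobustRank (comb (contract V F)) (Submodule.span ℝ (Set.range G)) (Fintype.card β ^ (d + 1))
      (t / √(Fintype.card β)) := by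
  refine RobustRank.of_comp_equiv (Fin.snocEquiv fun _ => β) ?_
  have := robustRank_uncurry_of_forall (C := fun b => contract (fun j => V j.castSucc)
      (contractFst (V (Fin.last d) b) (splitLast F))) ht
    (fun b => span_le_span_otherContractions (V (Fin.last d)) (splitLast F) G b)
    (fun j b hb J => contract_mem_span _ _ _ fun I =>
      contractFst_mem_span_otherContractions _ _ _ hb I)
    (fun b => by simpa using h b)
  rw [pow_succ']
  convert this using 2
  · ext ⟨b, J⟩
    exact contract_snoc V F J b
  · simp

omit [FiniteDimensional ℝ Y] in
lemma RobustRank.splitLast {d : ℕ} {F : (Fin (d + 1) → ι) → Y} {E : Submodule ℝ Y} {R : ℕ} {θ : ℝ}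
    (h : RobustRank (comb F) E R θ) :
    RobustRank (comb (Function.uncurry (splitLast F))) E R θ := by
  refine RobustRank.of_comp_equiv (Fin.snocEquiv fun _ => ι).symm ?_
  convert h using 2
  ext I
  exact congrArg F ((Fin.snocEquiv fun _ => ι).apply_symm_apply I)

omit [Fintype ι] [NormedAddCommGroup Y] [InnerProductSpace ℝ Y] [FiniteDimensional ℝ Y] in
lemma measurable_splitLast [MeasurableSpace Y] {d : ℕ} :
    Measurable fun F : (Fin (d + 1) → ι) → Y => splitLast F := by
  unfold splitLast
  fun_prop

/-- The first step of the contraction of a random tensor: it keeps a constant proportion of the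
large singular values, modulo the contractions with the other rows. -/
lemma measure_first_contraction_le [MeasurableSpace Y] [BorelSpace Y] {Ω : Type*}
    [MeasurableSpace Ω] {P : Measure Ω} [IsProbabilityMeasure P] {κ' : Type*} [Fintype κ']
    {U Z : Ω → β → ι → ℝ} {F : Ω → ι → κ → Y} {G : Ω → κ' → Y}
    {ρ θ : ℝ} (hρ : 0 < ρ) (hθ : 0 < θ)
    (hU : AEMeasurable U P) (hF : AEMeasurable F P) (hG : AEMeasurable G P)
    (hZ : HasLaw Z
      (Measure.pi fun _ : β => Measure.pi fun _ : ι => gaussianReal 0 (ρ ^ 2).toNNReal) P)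
    (hind : IndepFun Z (fun ω => (U ω, F ω, G ω)) P) {r r' k R : ℕ} (hr : 2 * r' ≤ r + 1)
    (hR : Fintype.card ι * (r - 1) + k * Fintype.card κ +
      (Fintype.card β - 1) * Fintype.card κ < R + Fintype.card κ) (b : β) :
    P {ω | RobustRank (comb (Function.uncurry (F ω))) (Submodule.span ℝ (Set.range (G ω))) R θ ∧
      ¬ RobustRank (comb (contractFst ((U ω + Z ω) b) (F ω)))
        (Submodule.span ℝ (Set.range (otherContractions (U ω + Z ω) (F ω) (G ω) b))) r'
        (ρ * θ / (4 * √(Fintype.card ι)))} ≤ ENNReal.ofReal (1 / 4) ^ k := by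
  have hX : AEMeasurable (fun ω => (U ω, F ω, G ω)) P := hU.prodMk (hF.prodMk hG)
  let S : Set ((β → ι → ℝ) × ((β → ι → ℝ) × (ι → κ → Y) × (κ' → Y))) :=
    {p | RobustRank (comb (Function.uncurry p.2.2.1))
        (Submodule.span ℝ (Set.range p.2.2.2)) R θ ∧
      ¬ RobustRank (comb (contractFst ((p.2.1 + p.1) b) p.2.2.1))
        (Submodule.span ℝ (Set.range (otherContractions (p.2.1 + p.1) p.2.2.1 p.2.2.2 b))) r'
        (ρ * θ / (4 * √(Fintype.card ι)))}
  have hS : MeasurableSet S := by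
    refine MeasurableSet.inter ?_ (MeasurableSet.compl ?_)
    · have hm : Measurable fun p : (β → ι → ℝ) × ((β → ι → ℝ) × (ι → κ → Y) × (κ' → Y)) =>
          (Function.uncurry p.2.2.1, p.2.2.2) :=
        (measurable_uncurry.comp measurable_snd.snd.fst).prodMk measurable_snd.snd.snd
      exact hm (isClosed_robustRank R θ).measurableSet
    · have hm : Measurable fun p : (β → ι → ℝ) × ((β → ι → ℝ) × (ι → κ → Y) × (κ' → Y)) =>
          (p.2.1 + p.1, p.2.2.1, p.2.2.2) :=
        (measurable_snd.fst.add measurable_fst).prodMk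
          (measurable_snd.snd.fst.prodMk measurable_snd.snd.snd)
      exact hm (measurableSet_robustRank_otherContractions b _ _)
  -- By independence the joint law is a product, so `(U, F, G)` can be frozen and the
  -- deterministic-base estimate applied to `Z`.
  have hmap := (indepFun_iff_map_prod_eq_prod_map_map hZ.aemeasurable hX).1 hind
  rw [hZ.map_eq] at hmap
  have : IsProbabilityMeasure (P.map fun ω => (U ω, F ω, G ω)) := Measure.isProbabilityMeasure_map hX
  calc _ = P.map (fun ω => (Z ω, (U ω, F ω, G ω))) S := by
        rw [Measure.map_apply_of_aemeasurable (hZ.aemeasurable.prodMk hX) hS]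
        rfl
    _ ≤ ∫⁻ _, ENNReal.ofReal (1 / 4) ^ k ∂(P.map fun ω => (U ω, F ω, G ω)) := by
        rw [hmap, Measure.prod_apply_symm hS]
        refine lintegral_mono fun p => ?_
        by_cases hp : RobustRank (comb (Function.uncurry p.2.1))
          (Submodule.span ℝ (Set.range p.2.2)) R θ
        · refine le_trans (measure_mono ?_)
            (measure_not_robustRank_otherContractions_le p.1 hρ hθ hr hp hR b)
          exact fun z hz => hz.2
        · rw [Set.eq_empty_of_forall_notMem (s := (fun z => (z, p)) ⁻¹' S) fun z hz => hp hz.1,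
            measure_empty]
          exact zero_le
    _ = _ := by simp

end contract

/-! ### The induction on the order of the tensor -/

/-- A union bound over `m` rows. -/
lemma card_mul_add_exp_le {m d : ℕ} (hm : 1 ≤ m) (a : ℝ) :
    (m : ℝ) * (Real.exp (-a) + d * (m : ℝ) ^ d * Real.exp (-a)) ≤
      ((d + 1 : ℕ) : ℝ) * (m : ℝ) ^ (d + 1) * Real.exp (-a) := by
  have h1 : (1 : ℝ) ≤ m := by exact_mod_cast hm
  have h2 : (m : ℝ) ≤ m ^ (d + 1) := le_self_pow₀ h1 (by omega)
  have h3 := mul_le_mul_of_nonneg_right h2 (Real.exp_pos (-a)).le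
  push_cast
  rw [pow_succ'] at *
  nlinarith

/-- The parameters of the first contraction. -/
lemma exists_contraction_parameters {n m N R : ℕ} {δ : ℝ} (hm : 1 ≤ m) (hN : 1 ≤ N)
    (hδ : 0 < δ) (hmn : 32 * (m : ℝ) ≤ δ * n) (hR : δ * (n * N) ≤ R) :
    ∃ r r' k : ℕ, 2 * r' ≤ r + 1 ∧ n * (r - 1) + k * N + (m - 1) * N < R + N ∧
      δ / 16 * N ≤ r' ∧ δ * n / 8 ≤ k := by
  have hN' : (1 : ℝ) ≤ N := by exact_mod_cast hN
  have hm' : (1 : ℝ) ≤ m := by exact_mod_cast hm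
  have hδN : 0 < δ * N := by positivity
  have hδn : 0 < δ * n := by linarith
  -- Of the rank `δ n N`, a share `1/8` goes to the choice of a block, `1/8` to the `k` quotients
  -- and `1/32` to the other rows. Halving `r` then gives `δ / 16`.
  set r := ⌈δ * N / 8⌉₊ with hr
  set k := ⌈δ * n / 8⌉₊ with hk
  have hr0 : 0 < r := Nat.ceil_pos.2 (by positivity)
  have hr1 : (r : ℝ) < δ * N / 8 + 1 := Nat.ceil_lt_add_one (by positivity)
  have hk1 : (k : ℝ) < δ * n / 8 + 1 := Nat.ceil_lt_add_one (by positivity)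
  refine ⟨r, (r + 1) / 2, k, by omega, ?_, ?_, Nat.le_ceil _⟩
  · have h1 : ((r - 1 : ℕ) : ℝ) = r - 1 := by push_cast [Nat.cast_sub hr0]; ring
    have h2 : ((m - 1 : ℕ) : ℝ) = m - 1 := by push_cast [Nat.cast_sub hm]; ring
    rify
    rw [h1, h2]
    have h3 : (n : ℝ) * (r - 1) ≤ n * (δ * N / 8) :=
      mul_le_mul_of_nonneg_left (by linarith) (Nat.cast_nonneg n)
    have h4 : (k : ℝ) * N ≤ (δ * n / 8 + 1) * N := by gcongr
    have h5 : 32 * (m : ℝ) * N ≤ δ * n * N := by gcongr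
    have h6 : 0 < δ * n * N := by positivity
    nlinarith
  · have h1 : (r : ℝ) ≤ 2 * ((r + 1) / 2 : ℕ) := by
      have : r ≤ 2 * ((r + 1) / 2) := by omega
      exact_mod_cast this
    have h2 : δ * N / 8 ≤ r := Nat.le_ceil _
    linarith

section main

variable {β ι : Type} {Y Ω : Type*} [Fintype β] [DecidableEq β] [Nonempty β] [Fintype ι]
  [NormedAddCommGroup Y] [InnerProductSpace ℝ Y] [FiniteDimensional ℝ Y] [MeasurableSpace Y]
  [BorelSpace Y] [MeasurableSpace Ω] {P : Measure Ω} [IsProbabilityMeasure P]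

/-- The probability that the contraction of a random tensor with `d` random matrices, generated
from the last one to the first one, loses injectivity. -/
lemma measure_not_robustRank_contract_le {ρ : ℝ} (hρ : 0 < ρ) (d : ℕ) {κ : Type} [Fintype κ]
    {U Z : Fin d → Ω → β → ι → ℝ} {F : Ω → (Fin d → ι) → Y} {G : Ω → κ → Y}
    (hU : ∀ j, AEMeasurable (U j) P) (hF : AEMeasurable F P) (hG : AEMeasurable G P)
    (hZ : ∀ j, HasLaw (Z j)
      (Measure.pi fun _ : β => Measure.pi fun _ : ι => gaussianReal 0 (ρ ^ 2).toNNReal) P)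
    (hind : ∀ j, IndepFun (Z j) (fun ω => (U j ω,
      (fun k : {k : Fin d // j < k} => U k ω + Z k ω), F ω, G ω)) P)
    {δ θ : ℝ} (hδ : 0 < δ) (hθ : 0 < θ) {R : ℕ} (hR : δ * (Fintype.card ι : ℝ) ^ d ≤ R)
    (hm : 2 * 16 ^ d * (Fintype.card β : ℝ) ≤ δ * Fintype.card ι) :
    P {ω | RobustRank (comb (F ω)) (Submodule.span ℝ (Set.range (G ω))) R θ ∧
      ¬ RobustRank (comb (contract (fun j => U j ω + Z j ω) (F ω)))
        (Submodule.span ℝ (Set.range (G ω))) (Fintype.card β ^ d)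
        (θ * (ρ / (4 * √(Fintype.card ι) * √(Fintype.card β))) ^ d)} ≤
      ENNReal.ofReal (d * (Fintype.card β : ℝ) ^ d * Real.exp (-(δ * Fintype.card ι / 16 ^ d))) := by
  -- `F` and `G` are random because the next step replaces them by the contraction with one row of
  -- the last matrix and by the contractions with its other rows.
  induction d generalizing κ δ θ R with
  | zero =>
    refine le_trans (le_of_eq ?_) zero_le
    rw [Set.eq_empty_of_forall_notMem (s := {ω | _}), measure_empty]
    rintro ω ⟨h1, h2⟩
    refine h2 (h1.contract_zero.mono le_rfl ?_ (by simp))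
    have : (0 : ℝ) < R := by
      refine lt_of_lt_of_le ?_ hR
      simpa using hδ
    rw [pow_zero]
    exact_mod_cast this
  | succ d ih =>
    have hβ : 1 ≤ Fintype.card β := Fintype.card_pos
    have hβ' : (1 : ℝ) ≤ Fintype.card β := by exact_mod_cast hβ
    have h16 : (1 : ℝ) ≤ 16 ^ d := one_le_pow₀ (by norm_num)
    have hn : 0 < Fintype.card ι := by
      by_contra! h0
      rw [Nat.le_zero.1 h0] at hm
      have : (0 : ℝ) < 2 * 16 ^ (d + 1) * Fintype.card β := by positivity
      simp at hm
      linarith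
    have hn' : (0 : ℝ) < Fintype.card ι := by exact_mod_cast hn
    have hm32 : 32 * (Fintype.card β : ℝ) ≤ δ * Fintype.card ι := by
      refine le_trans ?_ hm
      rw [pow_succ]
      nlinarith
    obtain ⟨r, r', k, hr, hlt, hr', hk⟩ := exists_contraction_parameters (n := Fintype.card ι)
      (N := Fintype.card (Fin d → ι)) (R := R) hβ (by simpa using Nat.one_le_pow _ _ hn) hδ hm32
      (by simpa [pow_succ'] using hR)
    let V : Ω → β → ι → ℝ := fun ω => U (Fin.last d) ω + Z (Fin.last d) ω
    have hV : AEMeasurable V P := (hU _).add (hZ _).aemeasurable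
    let F' : Ω → ι → (Fin d → ι) → Y := fun ω => splitLast (F ω)
    have hF' : AEMeasurable F' P := measurable_splitLast.comp_aemeasurable hF
    set θ' := ρ * θ / (4 * √(Fintype.card ι)) with hθ'
    have hθ'0 : 0 < θ' := by positivity
    set t := θ' * (ρ / (4 * √(Fintype.card ι) * √(Fintype.card β))) ^ d with ht
    let a := δ * Fintype.card ι / 16 ^ (d + 1)
    -- `A b`: the first contraction with row `b` loses too much rank. `B b`: it keeps enough, but
    -- the remaining contractions fail.
    let A : β → Set Ω := fun b =>
      {ω | RobustRank (comb (Function.uncurry (F' ω))) (Submodule.span ℝ (Set.range (G ω))) R θ ∧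
      ¬ RobustRank (comb (contractFst (V ω b) (F' ω)))
        (Submodule.span ℝ (Set.range (otherContractions (V ω) (F' ω) (G ω) b))) r' θ'}
    let B : β → Set Ω := fun b =>
      {ω | RobustRank (comb (contractFst (V ω b) (F' ω)))
        (Submodule.span ℝ (Set.range (otherContractions (V ω) (F' ω) (G ω) b))) r' θ' ∧
      ¬ RobustRank (comb (contract (fun j : Fin d => U j.castSucc ω + Z j.castSucc ω)
          (contractFst (V ω b) (F' ω))))
        (Submodule.span ℝ (Set.range (otherContractions (V ω) (F' ω) (G ω) b)))
        (Fintype.card β ^ d) t}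
    have hsub : {ω | RobustRank (comb (F ω)) (Submodule.span ℝ (Set.range (G ω))) R θ ∧
      ¬ RobustRank (comb (contract (fun j => U j ω + Z j ω) (F ω)))
        (Submodule.span ℝ (Set.range (G ω))) (Fintype.card β ^ (d + 1))
        (θ * (ρ / (4 * √(Fintype.card ι) * √(Fintype.card β))) ^ (d + 1))} ⊆
        ⋃ b, (A b ∪ B b) := by
      rintro ω ⟨h1, h2⟩
      by_contra hc
      simp only [Set.mem_iUnion, not_exists, Set.mem_union, not_or] at hc
      refine h2 ?_
      have h3 := robustRank_contract_succ (fun j => U j ω + Z j ω) (F ω) (G ω) (t := t)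
        (by positivity) fun b => by
          by_contra h4
          by_cases h5 : RobustRank (comb (contractFst (V ω b) (F' ω)))
            (Submodule.span ℝ (Set.range (otherContractions (V ω) (F' ω) (G ω) b))) r' θ'
          · exact (hc b).2 ⟨h5, h4⟩
          · exact (hc b).1 ⟨h1.splitLast, h5⟩
      refine h3.mono le_rfl le_rfl (le_of_eq ?_)
      rw [ht, hθ', pow_succ]
      field_simp
    have hA : ∀ b, P (A b) ≤ ENNReal.ofReal (Real.exp (-a)) := by
      intro b
      refine (measure_first_contraction_le hρ hθ (hU (Fin.last d)) hF' hG (hZ (Fin.last d)) ?_ hr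
        hlt b).trans ?_
      · have hφ : Measurable fun p : (β → ι → ℝ) ×
            ({k : Fin (d + 1) // Fin.last d < k} → β → ι → ℝ) ×
            ((Fin (d + 1) → ι) → Y) × (κ → Y) => (p.1, splitLast p.2.2.1, p.2.2.2) :=
          measurable_fst.prodMk ((measurable_splitLast.comp measurable_snd.snd.fst).prodMk
            measurable_snd.snd.snd)
        exact (hind (Fin.last d)).comp measurable_id hφ
      · rw [← ENNReal.ofReal_pow (by norm_num)]
        refine ENNReal.ofReal_le_ofReal ?_
        have h1 : (1 / 4 : ℝ) ≤ Real.exp (-1) := by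
          rw [Real.exp_neg, one_div]
          exact inv_anti₀ (Real.exp_pos 1) (Real.exp_one_lt_d9.le.trans (by norm_num))
        calc (1 / 4 : ℝ) ^ k ≤ Real.exp (-1) ^ k := by gcongr
          _ = Real.exp (-k) := by rw [← Real.exp_nat_mul]; simp
          _ ≤ Real.exp (-a) := by
            refine Real.exp_le_exp.2 (neg_le_neg (le_trans ?_ hk))
            refine div_le_div_of_nonneg_left (by positivity) (by norm_num) ?_
            rw [pow_succ]
            linarith
    have hB : ∀ b, P (B b) ≤ ENNReal.ofReal (d * (Fintype.card β : ℝ) ^ d * Real.exp (-a)) := by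
      intro b
      have hFb : AEMeasurable (fun ω => contractFst (V ω b) (F' ω)) P :=
        continuous_contractFst.measurable.comp_aemeasurable
          (((measurable_pi_apply b).comp_aemeasurable hV).prodMk hF')
      have hGb : AEMeasurable (fun ω => otherContractions (V ω) (F' ω) (G ω) b) P :=
        (continuous_otherContractions b).measurable.comp_aemeasurable (hV.prodMk (hF'.prodMk hG))
      have hR' : δ / 16 * (Fintype.card ι : ℝ) ^ d ≤ r' := by simpa using hr'
      have hm' : 2 * 16 ^ d * (Fintype.card β : ℝ) ≤ δ / 16 * Fintype.card ι := by
        rw [pow_succ] at hm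
        linarith
      have := ih (U := fun j => U j.castSucc) (Z := fun j => Z j.castSucc) (fun j => hU _) hFb hGb
        (fun j => hZ _) ?_ (by positivity) hθ'0 hR' hm'
      · refine this.trans (le_of_eq ?_)
        congr 4
        simp only [a, pow_succ]
        field_simp
      · intro j
        -- The new `F` and `G` are functions of the last matrix and the old data. As `Fin.last d`
        -- exceeds `j`, that matrix is among those jointly independent of the noise at `j`.
        have hφ : Measurable fun p : (β → ι → ℝ) ×
            ({k : Fin (d + 1) // j.castSucc < k} → β → ι → ℝ) ×
            ((Fin (d + 1) → ι) → Y) × (κ → Y) =>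
            (p.1, (fun k : {k : Fin d // j < k} => p.2.1 ⟨k.1.castSucc, k.2⟩),
              contractFst (p.2.1 ⟨Fin.last d, Fin.castSucc_lt_last j⟩ b) (splitLast p.2.2.1),
              otherContractions (p.2.1 ⟨Fin.last d, Fin.castSucc_lt_last j⟩) (splitLast p.2.2.1)
                p.2.2.2 b) := by
          have h1 : Measurable fun p : (β → ι → ℝ) ×
              ({k : Fin (d + 1) // j.castSucc < k} → β → ι → ℝ) ×
              ((Fin (d + 1) → ι) → Y) × (κ → Y) =>
              p.2.1 ⟨Fin.last d, Fin.castSucc_lt_last j⟩ :=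
            (measurable_pi_apply _).comp measurable_snd.fst
          have h2 : Measurable fun p : (β → ι → ℝ) ×
              ({k : Fin (d + 1) // j.castSucc < k} → β → ι → ℝ) ×
              ((Fin (d + 1) → ι) → Y) × (κ → Y) => splitLast p.2.2.1 :=
            measurable_splitLast.comp measurable_snd.snd.fst
          refine measurable_fst.prodMk (Measurable.prodMk ?_ (Measurable.prodMk ?_ ?_))
          · exact measurable_pi_lambda _ fun k => (measurable_pi_apply _).comp measurable_snd.fst
          · exact continuous_contractFst.measurable.comp
              (((measurable_pi_apply b).comp h1).prodMk h2)
          · exact (continuous_otherContractions b).measurable.comp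
              (h1.prodMk (h2.prodMk measurable_snd.snd.snd))
        exact (hind j.castSucc).comp measurable_id hφ
    calc _ ≤ P (⋃ b, (A b ∪ B b)) := measure_mono hsub
      _ ≤ ∑ b, P (A b ∪ B b) := measure_iUnion_fintype_le _ _
      _ ≤ ∑ _b : β, ENNReal.ofReal (Real.exp (-a) +
            d * (Fintype.card β : ℝ) ^ d * Real.exp (-a)) := by
          refine Finset.sum_le_sum fun b _ => (measure_union_le _ _).trans ?_
          rw [ENNReal.ofReal_add (by positivity) (by positivity)]
          exact add_le_add (hA b) (hB b)
      _ = ENNReal.ofReal (Fintype.card β * (Real.exp (-a) +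
            d * (Fintype.card β : ℝ) ^ d * Real.exp (-a))) := by
          rw [ENNReal.ofReal_mul (by positivity)]
          simp
      _ ≤ _ := ENNReal.ofReal_le_ofReal (card_mul_add_exp_le hβ a)

end main

/-! ### Translation to matrices, and the final estimates -/

lemma eq_comb_single {κ Y : Type*} [Fintype κ] [DecidableEq κ] [AddCommGroup Y] [Module ℝ Y]
    (T : EuclideanSpace ℝ κ →ₗ[ℝ] Y) : T = comb fun k => T (EuclideanSpace.single k 1) := by
  refine (EuclideanSpace.basisFun κ ℝ).toBasis.ext fun k => ?_
  simp [comb, Fintype.linearCombination_apply]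

/-- The matrices are transposed here: columns of `U j` become the rows used by `contract`. -/
lemma modalContraction_eq_comb {d n m D : ℕ}
    (Ψ : TensorSpace n d →ₗ[ℝ] EuclideanSpace ℝ (Fin D))
    (U : Fin d → Matrix (Fin n) (Fin m) ℝ) :
    modalContraction Ψ U =
      comb (contract (fun j b a => U j a b) fun I => Ψ (EuclideanSpace.single I 1)) := by
  rw [eq_comb_single (modalContraction Ψ U)]
  congr 1
  ext1 J
  have h : (kronecker U).toEuclideanLin (EuclideanSpace.single J 1) =
      ∑ I, (∏ j, U j (I j) (J j)) • EuclideanSpace.single I (1 : ℝ) := by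
    ext I
    simp [kronecker, Pi.single_apply]
  simp only [modalContraction, LinearMap.comp_apply, h, map_sum, map_smul, contract]

lemma IsIIDGaussianMatrix.hasLaw_transpose {Ω : Type*} [MeasurableSpace Ω] {P : Measure Ω}
    [IsProbabilityMeasure P] {n m : ℕ} {ρ : ℝ} {Z : Ω → Matrix (Fin n) (Fin m) ℝ}
    (h : IsIIDGaussianMatrix P ρ Z) :
    HasLaw (fun ω b a => Z ω a b)
      (Measure.pi fun _ : Fin m => Measure.pi fun _ : Fin n => gaussianReal 0 (ρ ^ 2).toNNReal)
      P := by
  have hae : AEMeasurable (fun ω (p : Fin m × Fin n) => Z ω p.2 p.1) P :=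
    aemeasurable_pi_lambda _ fun p => (h.law p.2 p.1).aemeasurable
  refine ⟨aemeasurable_pi_lambda _ fun b => aemeasurable_pi_lambda _ fun a =>
    (h.law a b).aemeasurable, ?_⟩
  have h1 := (h.indep.precomp (Prod.swap_injective (α := Fin m) (β := Fin n))).map_fun_eq_pi_map
    fun p : Fin m × Fin n => (h.law p.2 p.1).aemeasurable
  simp only [(h.law _ _).map_eq] at h1
  have h2 := Measure.infinitePi_map_curry
    fun (_ : Fin m) (_ : Fin n) => gaussianReal 0 (ρ ^ 2).toNNReal
  simp only [Measure.infinitePi_eq_pi] at h2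
  rw [← h2, ← h1, AEMeasurable.map_map_of_aemeasurable (by fun_prop) hae]
  rfl

lemma IsBackwardPerturbation.indepFun_transpose {Ω : Type*} [MeasurableSpace Ω] {P : Measure Ω}
    {d n m : ℕ} {ρ : ℝ} {U Z : Fin d → Ω → Matrix (Fin n) (Fin m) ℝ}
    (h : IsBackwardPerturbation P ρ U Z) {A B : Type*} [MeasurableSpace A] [MeasurableSpace B]
    (f : A) (g : B) (j : Fin d) :
    IndepFun (fun ω b a => Z j ω a b) (fun ω => ((fun b a => U j ω a b : Fin m → Fin n → ℝ),
      (fun k : {k : Fin d // j < k} =>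
        ((fun b a => U k ω a b : Fin m → Fin n → ℝ) + fun b a => Z k ω a b)), f, g)) P := by
  have hφ : Measurable fun z : Fin n → Fin m → ℝ => fun b a => z a b := by fun_prop
  have hψ : Measurable fun p : (Fin n → Fin m → ℝ) × ({k : Fin d // j < k} → Fin n → Fin m → ℝ) =>
      ((fun b a => p.1 a b : Fin m → Fin n → ℝ),
        (fun k b a => p.2 k a b : {k : Fin d // j < k} → Fin m → Fin n → ℝ), f, g) := by
    fun_prop
  exact (h.indep j).comp hφ hψ

/-- This turns a proportion `δ` of the binomial coefficient into a proportion `δ / d!` of the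
dimension `n ^ d`. -/
lemma pow_le_factorial_mul_choose (n d : ℕ) :
    n ^ d ≤ d.factorial * (n + d - 1).choose d := by
  rw [← Nat.ascFactorial_eq_factorial_mul_choose']
  exact Nat.pow_succ_le_ascFactorial n d

/-- The polynomial factor is absorbed by the exponential. -/
lemma mul_pow_mul_exp_neg_le {d : ℕ} (hd : 1 ≤ d) {x a : ℝ} (hx : 0 ≤ x)
    (hxa : 2 * (d * d.factorial) * x ≤ a) :
    d * x ^ d * Real.exp (-a) ≤ Real.exp (-(a / 2)) := by
  have hd' : (1 : ℝ) ≤ d := by exact_mod_cast hd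
  have hf : (1 : ℝ) ≤ d.factorial := by exact_mod_cast Nat.one_le_iff_ne_zero.2 d.factorial_ne_zero
  have hdf : (1 : ℝ) ≤ d * d.factorial := by nlinarith
  have ha : 0 ≤ a := le_trans (by positivity) hxa
  -- One term of the exponential series suffices: the factor `d * d!` in `hxa` pays for both the
  -- coefficient `d` and the denominator `d!`.
  have h1 := Real.pow_div_factorial_le_exp (x := a / 2) (by positivity) d
  have h2 : (d * d.factorial * x) ^ d ≤ (a / 2) ^ d := by
    gcongr
    linarith
  have h3 : d * x ^ d ≤ Real.exp (a / 2) := by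
    refine le_trans ?_ h1
    rw [le_div_iff₀ (by positivity)]
    refine le_trans ?_ h2
    rw [mul_pow]
    have := mul_le_mul_of_nonneg_right (le_self_pow₀ hdf (by omega : d ≠ 0)) (pow_nonneg hx d)
    linarith
  calc d * x ^ d * Real.exp (-a) ≤ Real.exp (a / 2) * Real.exp (-a) := by gcongr
    _ = _ := by rw [← Real.exp_add]; congr 1; ring

theorem theorem5p2 :
    ∃ c₀ : ℝ, 1 ≤ c₀ ∧
    ∀ d : ℕ, 1 ≤ d →
    ∃ c c' : ℝ, 0 < c ∧ 0 < c' ∧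
    ∀ δ : ℝ, 0 < δ →
    ∃ κ : ℝ, 0 < κ ∧
    ∀ (n m D R : ℕ), 1 ≤ m → (m : ℝ) ≤ c * δ * n →
    (R : ℝ) = δ * ((n + d - 1).choose d : ℝ) →
    ∀ Ψ : TensorSpace n d →ₗ[ℝ] EuclideanSpace ℝ (Fin D), 1 ≤ kthSingularValue R Ψ →
    ∀ ρ : ℝ, 0 < ρ →
    ∀ (Ω : Type*) [MeasurableSpace Ω] (P : Measure Ω) [IsProbabilityMeasure P]
      (U Z : Fin d → Ω → Matrix (Fin n) (Fin m) ℝ), IsBackwardPerturbation P ρ U Z →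
    1 - Real.exp (-(κ * n)) ≤
      P.real {ω | c' * ρ ^ d / (n : ℝ) ^ (c₀ * d) ≤
        kthSingularValue (m ^ d) (modalContraction Ψ fun j => U j ω + Z j ω)} := by
  refine ⟨1, le_rfl, fun d hd => ?_⟩
  have hd' : (1 : ℝ) ≤ d := by exact_mod_cast hd
  have hf : (1 : ℝ) ≤ d.factorial := by exact_mod_cast Nat.one_le_iff_ne_zero.2 d.factorial_ne_zero
  -- In `c`, the factor `d! * 16 ^ d` comes from `δ / d!` and the induction, and `2 * (d * d!)` from
  -- absorbing the polynomial, which also halves the exponent in `κ`.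
  refine ⟨1 / (d.factorial * 16 ^ d * (2 * (d * d.factorial))), (1 / 4) ^ d, by positivity,
    by positivity, fun δ hδ => ⟨δ / (d.factorial * 16 ^ d * 2), by positivity, ?_⟩⟩
  intro n m D R hm hmn hR Ψ hΨ ρ hρ Ω _ P _ U Z h
  have hm' : (1 : ℝ) ≤ m := by exact_mod_cast hm
  have hn : 0 < n := by
    by_contra! h0
    rw [Nat.le_zero.1 h0] at hmn
    simp at hmn
    linarith
  have hn' : (0 : ℝ) < n := by exact_mod_cast hn
  have : Nonempty (Fin m) := ⟨⟨0, hm⟩⟩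
  have hR0 : 0 < R := by
    have : 0 < (n + d - 1).choose d := Nat.choose_pos (by omega)
    have : (0 : ℝ) < R := by rw [hR]; positivity
    exact_mod_cast this
  have hrob := robustRank_of_le_singularValues Ψ hR0 one_pos hΨ
  set δ' := δ / d.factorial with hδ'
  have hδ'0 : 0 < δ' := by positivity
  have hRδ : δ' * (n : ℝ) ^ d ≤ R := by
    have : (n : ℝ) ^ d ≤ d.factorial * (n + d - 1).choose d := by
      exact_mod_cast pow_le_factorial_mul_choose n d
    rw [hR, hδ', div_mul_eq_mul_div, div_le_iff₀ (by positivity)]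
    nlinarith
  have hma : 2 * (d * d.factorial) * (m : ℝ) ≤ δ' * n / 16 ^ d := by
    rw [hδ', le_div_iff₀ (by positivity)]
    calc _ ≤ 2 * (d * d.factorial) *
          (1 / (d.factorial * 16 ^ d * (2 * (d * d.factorial))) * δ * n) * (16 : ℝ) ^ d := by gcongr
      _ = _ := by field_simp
  have hm16 : 2 * 16 ^ d * (m : ℝ) ≤ δ' * n := by
    rw [le_div_iff₀ (by positivity)] at hma
    refine le_trans ?_ hma
    have h1 : (1 : ℝ) ≤ d * d.factorial := by nlinarith
    have h2 : (0 : ℝ) ≤ 2 * 16 ^ d * m := by positivity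
    nlinarith
  have hRn : R ≤ n ^ d := by
    obtain ⟨W, hW, -⟩ := hrob
    simpa using hW.trans (Submodule.finrank_le W)
  -- A robust rank `R` forces `R ≤ n ^ d`, hence `δ' ≤ 1` and `m ≤ n`; this yields `√n * √m ≤ n` and
  -- so the exponent `c₀ = 1`.
  have hδ1 : δ' ≤ 1 := by
    have : (R : ℝ) ≤ n ^ d := by exact_mod_cast hRn
    have h1 : δ' * (n : ℝ) ^ d ≤ 1 * (n : ℝ) ^ d := by linarith
    exact le_of_mul_le_mul_right h1 (by positivity)
  have hmlen : (m : ℝ) ≤ n := by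
    have h1 : (1 : ℝ) ≤ 16 ^ d := one_le_pow₀ (by norm_num)
    have h2 : (m : ℝ) ≤ 2 * 16 ^ d * m := by nlinarith
    have h3 : δ' * n ≤ 1 * n := by gcongr
    linarith
  let F : (Fin d → Fin n) → EuclideanSpace ℝ (Fin D) := fun I => Ψ (EuclideanSpace.single I 1)
  -- The induction starts with nothing quotiented out.
  let G : Empty → EuclideanSpace ℝ (Fin D) := Empty.elim
  have hG : Submodule.span ℝ (Set.range G) = ⊥ := by simp
  let Bad : Set Ω := {ω | ¬ RobustRank (modalContraction Ψ fun j => U j ω + Z j ω) ⊥ (m ^ d)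
    ((ρ / (4 * √n * √m)) ^ d)}
  have hBad : P Bad ≤ ENNReal.ofReal (Real.exp (-(δ / (d.factorial * 16 ^ d * 2) * n))) := by
    have hmain := measure_not_robustRank_contract_le (P := P) (β := Fin m) (ι := Fin n) hρ d
      (U := fun j ω b a => U j ω a b) (Z := fun j ω b a => Z j ω a b) (F := fun _ => F)
      (G := fun _ => G)
      (fun j => aemeasurable_pi_lambda _ fun b => aemeasurable_pi_lambda _ fun a =>
        h.aemeasurable_base j a b)
      aemeasurable_const aemeasurable_const (fun j => (h.gaussian_noise j).hasLaw_transpose)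
      (h.indepFun_transpose F G) hδ'0 one_pos (R := R) (by simpa using hRδ) (by simpa using hm16)
    refine (measure_mono ?_).trans (hmain.trans (ENNReal.ofReal_le_ofReal ?_))
    · intro ω hω
      refine ⟨?_, ?_⟩
      · rwa [hG, ← eq_comb_single Ψ]
      · rw [hG]
        intro hc
        refine hω ?_
        rw [modalContraction_eq_comb]
        simp only [Fintype.card_fin, one_mul] at hc
        exact hc
    · simp only [Fintype.card_fin]
      refine (mul_pow_mul_exp_neg_le hd (by positivity) hma).trans (le_of_eq ?_)
      rw [hδ']
      congr 2
      field_simp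
  have hcover : (Set.univ : Set Ω) ⊆ Bad ∪ {ω | (1 / 4) ^ d * ρ ^ d / (n : ℝ) ^ ((1 : ℝ) * d) ≤
        kthSingularValue (m ^ d) (modalContraction Ψ fun j => U j ω + Z j ω)} := by
    intro ω _
    by_cases hω : ω ∈ Bad
    · exact Or.inl hω
    · right
      have h1 := (not_not.1 hω).le_singularValues (by simp) (by positivity)
      refine le_trans ?_ h1
      rw [one_mul, Real.rpow_natCast, ← mul_pow, ← div_pow]
      have h2 : √(n : ℝ) * √m ≤ n := by
        calc √(n : ℝ) * √m ≤ √n * √n := by gcongr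
          _ = n := Real.mul_self_sqrt hn'.le
      refine pow_le_pow_left₀ (by positivity) ?_ d
      rw [one_div, ← div_eq_inv_mul, div_div, mul_assoc]
      gcongr
  have h1 := (measureReal_mono hcover (measure_ne_top P _)).trans (measureReal_union_le _ _)
  rw [probReal_univ] at h1
  have h2 : P.real Bad ≤ Real.exp (-(δ / (d.factorial * 16 ^ d * 2) * n)) :=
    ENNReal.toReal_le_of_le_ofReal (Real.exp_pos _).le hBad
  linarith
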